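/- Let $(M_0,g_0)$ and $(M_1,g_1)$ be connected smooth Riemannian manifolds without boundary, not necessarily complete, and let $\pi\colon M_1\to M_0$ be a Riemannian covering, that is, a smooth covering map with $\pi^*g_0=g_1$ (with any, possibly infinite, number of sheets). Let $V_0\colon M_0\to\mathbb R$ be a smooth function and set $V_1=V_0\circ\pi$. For a connected Riemannian manifold $M$ and a smooth function $V\colon M\to\mathbb R$ let $$\lambda_0(M,V)=\inf_f R(f)\in[-\infty,\infty),\qquad R(f)=\frac{\int_M\left(|\nabla f|^2+Vf^2\right)}{\int_M f^2},$$ where $f$ runs through all functions $f\colon M\to\mathbb R$ which are Lipschitz continuous with respect to the Riemannian distance, have compact support, and do not vanish identically, and where the integrals are taken with respect to the Riemannian volume. Then $$\lambda_0(M_0,V_0)\le\lambda_0(M_1,V_1).$$ -/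

import Mathlib

open scoped Manifold ContDiff ENNReal NNReal
open MeasureTheory Bundle

noncomputable section

section Manifold

variable (n : ℕ) {M : Type*} [EMetricSpace M] [ChartedSpace (EuclideanSpace ℝ (Fin n)) M]
  [RiemannianBundle (fun x : M ↦ TangentSpace (𝓡 n) x)]

/-- The coordinate vector field `∂ᵢ` of the chart at `x₀`, at the point of `M` with
coordinates `y`. -/
def chartVector (x₀ : M) (y : EuclideanSpace ℝ (Fin n)) (i : Fin n) :
    TangentSpace (𝓡 n) ((extChartAt (𝓡 n) x₀).symm y) :=
  mfderiv (𝓡 n) (𝓡 n) (extChartAt (𝓡 n) x₀).symm y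
    (EuclideanSpace.single i (1 : ℝ) : EuclideanSpace ℝ (Fin n))

/-- The volume density `√(det (gᵢⱼ))` in the chart at `x₀`, at the point with coordinates `y`,
where `gᵢⱼ = ⟨∂ᵢ, ∂ⱼ⟩`. -/
def chartDensity (x₀ : M) (y : EuclideanSpace ℝ (Fin n)) : ℝ :=
  Real.sqrt (Matrix.det (Matrix.of fun i j : Fin n ↦
    inner ℝ (chartVector n x₀ y i) (chartVector n x₀ y j)))

/-- The Riemannian volume of the domain of the chart at `x₀`, extended by zero to `M`: the
measure `√(det (gᵢⱼ)) dy¹ ⋯ dyⁿ` on the coordinate domain, transported to `M`. -/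
def chartVolume [MeasurableSpace M] (x₀ : M) : Measure M :=
  Measure.map (extChartAt (𝓡 n) x₀).symm
    ((volume.restrict (extChartAt (𝓡 n) x₀).target).withDensity
      fun y ↦ ENNReal.ofReal (chartDensity n x₀ y))

variable (M) in
/-- The Riemannian volume measure. By the change of variables formula, the measures
`chartVolume n x₀` agree on the overlaps of the chart domains; on a second countable manifold
their least upper bound is the unique Borel measure which restricts to each of them on the
domain of the chart. -/
def riemannianVolume [MeasurableSpace M] : Measure M :=
  ⨆ x₀ : M, chartVolume n x₀

/-- The differential of `f` at `x` (which is `0` if `f` is not differentiable at `x`), as a linear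
form on the tangent space. -/
def differentialAt (f : M → ℝ) (x : M) : TangentSpace (𝓡 n) x →L[ℝ] ℝ :=
  mfderiv (𝓡 n) 𝓘(ℝ, ℝ) f x

/-- The gradient of `f` at `x`: the vector which represents the differential of `f` at `x` with
respect to the Riemannian metric. -/
def riemannianGradient (f : M → ℝ) (x : M) : TangentSpace (𝓡 n) x :=
  haveI : FiniteDimensional ℝ (TangentSpace (𝓡 n) x) :=
    inferInstanceAs (FiniteDimensional ℝ (EuclideanSpace ℝ (Fin n)))
  haveI : CompleteSpace (TangentSpace (𝓡 n) x) := FiniteDimensional.complete ℝ _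
  (InnerProductSpace.toDual ℝ (TangentSpace (𝓡 n) x)).symm (differentialAt n f x)

/-- The Rayleigh quotient `R(f) = ∫ (|∇f|² + V f²) / ∫ f²`. -/
def rayleighQuotient [MeasurableSpace M] (V f : M → ℝ) : ℝ :=
  (∫ x, (‖riemannianGradient n f x‖ ^ 2 + V x * f x ^ 2) ∂(riemannianVolume n M)) /
    ∫ x, f x ^ 2 ∂(riemannianVolume n M)

/-- The competitors in the definition of the bottom of the spectrum: Lipschitz functions with
compact support which do not vanish identically. -/
structure IsCompetitor {M : Type*} [EMetricSpace M] (f : M → ℝ) : Prop where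
  lipschitz : ∃ K : ℝ≥0, LipschitzWith K f
  hasCompactSupport : HasCompactSupport f
  ne_zero : f ≠ 0

/-- The bottom of the spectrum `λ₀(M, V)` of `Δ + V`, the infimum of the Rayleigh quotients of
all competitors, which can be `-∞`. -/
def bottomOfSpectrum [MeasurableSpace M] (V : M → ℝ) : EReal :=
  ⨅ (f : M → ℝ) (_ : IsCompetitor f), (rayleighQuotient n V f : EReal)

end Manifold

/-- A Riemannian covering: a smooth covering map which is a local isometry. -/
structure IsRiemannianCovering (n : ℕ) {M₀ M₁ : Type*}
    [EMetricSpace M₀] [ChartedSpace (EuclideanSpace ℝ (Fin n)) M₀]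
    [RiemannianBundle (fun x : M₀ ↦ TangentSpace (𝓡 n) x)]
    [EMetricSpace M₁] [ChartedSpace (EuclideanSpace ℝ (Fin n)) M₁]
    [RiemannianBundle (fun x : M₁ ↦ TangentSpace (𝓡 n) x)]
    (p : M₁ → M₀) : Prop where
  isCoveringMap : IsCoveringMap p
  surjective : Function.Surjective p
  contMDiff : ContMDiff (𝓡 n) (𝓡 n) ∞ p
  inner_mfderiv : ∀ (y : M₁) (v w : TangentSpace (𝓡 n) y),
    inner ℝ (mfderiv (𝓡 n) (𝓡 n) p y v) (mfderiv (𝓡 n) (𝓡 n) p y w) = inner ℝ v w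

end

/-!
A competitor `f` on the covering space is pushed down to the base by taking the `ℓ²` norm over the
fibers: `g x = √(∑ z ∈ p⁻¹ {x}, f z ^ 2)`. The sum is finite since `f` has compact support. It is
shown that `g` is a competitor with `∫ W g² = ∫ (W ∘ p) f²` for every continuous `W` and
`∫ |∇g|² ≤ ∫ |∇f|²`, so that its Rayleigh quotient is at most that of `f`.

* Near a point of the base, the relevant part of the fiber is swept out by finitely many local
  sections `sᵢ` of `p` (`IsRiemannianCovering.exists_local_sections`, `tsum_fiber_eq_sum`), so that
  `g² = ∑ (f ∘ sᵢ)²`. The sections are isometries, hence Lipschitz with constant `1` on small sets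
  (`IsPartialIsometry.exists_lipschitzOnWith_symm`). Thus `g` is locally Lipschitz, and Lipschitz
  because its support is compact (`IsRiemannianCovering.isCompetitor_fiberNorm`).
* Where `g ≠ 0`, differentiating `g² = ∑ (f ∘ sᵢ)²` gives `g dg = ∑ (f ∘ sᵢ) d(f ∘ sᵢ)`, whence
  `|∇g|² (x) ≤ ∑ |∇f|² (z)`, summed over the fiber of `x`, by the Cauchy–Schwarz inequality
  (`IsRiemannianCovering.norm_riemannianGradient_fiberNorm_sq_le`). This uses differentiability
  of `f` along the whole fiber, which holds for almost every `x` by Rademacher's theorem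
  (`LipschitzWith.ae_mdifferentiableAt`), as the projection to the base preserves null sets.
* Integration over the covering space is integration over the base of the sums over the fibers
  (`IsRiemannianCovering.aemeasurable_tsum_fiber_and_lintegral_eq`). This reduces to the
  invariance of the volume under local isometries, which follows from the change of variables
  formula in charts (`IsPartialIsometry.chartVolume_eq`) once the least upper bound which defines
  the volume is identified with the chart measures on the domains of the charts
  (`riemannianVolume_eq_chartVolume`).

All integrals in the Rayleigh quotients are Bochner integrals, so the argument also needs that
`|∇f|²` and `W f²` are integrable: the gradient of a Lipschitz function is measurable and locally
bounded, and the volume is locally finite.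
-/

open Set Filter Topology

/-! ### Lipschitz estimates -/

section LipschitzEstimate

variable {E : Type*} [NormedAddCommGroup E] [NormedSpace ℝ E] {H : Type*} [TopologicalSpace H]
  {I : ModelWithCorners ℝ E H} {N : Type*} [PseudoEMetricSpace N] [ChartedSpace H N]
  [RiemannianBundle (fun x : N ↦ TangentSpace I x)] [IsRiemannianManifold I N]
  {F : Type*} [NormedAddCommGroup F] [NormedSpace ℝ F] {G : Type*} [TopologicalSpace G]
  {J : ModelWithCorners ℝ F G} {M : Type*} [PseudoEMetricSpace M] [ChartedSpace G M]
  [RiemannianBundle (fun x : M ↦ TangentSpace J x)] [IsRiemannianManifold J M]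

/-- A `C¹` map whose derivative is bounded by `C` near `x` is Lipschitz with the same constant `C`
near `x`, for the Riemannian distances. On a ball of a third of the radius, paths which are nearly
as short as the distance of their end points stay in the region where the bound holds. -/
theorem exists_lipschitzOnWith_of_enorm_mfderiv_le {s : N → M} {x : N} {C : ℝ≥0} {U : Set N}
    (hU : U ∈ 𝓝 x) (hs : ContMDiffOn I J 1 s U)
    (hC : ∀ y ∈ U, ∀ v : TangentSpace I y, ‖mfderiv I J s y v‖ₑ ≤ C * ‖v‖ₑ) :
    ∃ W ∈ 𝓝 x, LipschitzOnWith C s W := by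
  obtain ⟨r, hr, hrU⟩ := EMetric.mem_nhds_iff.1 (interior_mem_nhds.2 hU)
  have hr3 : 0 < r / 3 := ENNReal.div_pos hr.ne' (by simp)
  refine ⟨Metric.eball x (r / 3), Metric.eball_mem_nhds _ hr3, fun y hy z hz ↦ ?_⟩
  rw [Metric.mem_eball] at hy hz
  have hyz : edist y z < r / 3 + r / 3 :=
    (edist_triangle_right y z x).trans_lt (ENNReal.add_lt_add hy hz)
  -- the distance need not be attained by a path, so paths of any length `ρ > edist y z` are used
  have key : ∀ ρ ∈ Ioo (edist y z) (r / 3 + r / 3), edist (s y) (s z) ≤ C * ρ := by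
    intro ρ hρ
    have h1 := hρ.1
    rw [IsRiemannianManifold.out (I := I) y z] at h1
    obtain ⟨γ, h0, h1, hγ, hlen⟩ := Manifold.exists_lt_of_riemannianEDist_lt h1
    have hmem : ∀ t ∈ Icc (0 : ℝ) 1, γ t ∈ interior U := by
      intro t ht
      apply hrU
      rw [Metric.mem_eball]
      have : edist y (γ t) < r / 3 + r / 3 := by
        rw [IsRiemannianManifold.out (I := I) y]
        refine lt_of_le_of_lt ?_ (hlen.trans hρ.2)
        exact (Manifold.riemannianEDist_le_pathELength (hγ.mono (Icc_subset_Icc_right ht.2))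
          h0 rfl ht.1).trans (Manifold.pathELength_mono le_rfl ht.2)
      calc edist (γ t) x ≤ edist (γ t) y + edist y x := edist_triangle _ _ _
        _ < (r / 3 + r / 3) + r / 3 := by
            rw [edist_comm (γ t)]; exact ENNReal.add_lt_add this hy
        _ = r := ENNReal.add_thirds r
    have hsγ : ContMDiffOn 𝓘(ℝ, ℝ) J 1 (s ∘ γ) (Icc 0 1) :=
      hs.comp hγ fun t ht ↦ show γ t ∈ U from interior_subset (hmem t ht)
    rw [IsRiemannianManifold.out (I := J) (s y)]
    refine (Manifold.riemannianEDist_le_pathELength hsγ (by simp [h0]) (by simp [h1])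
      zero_le_one).trans ?_
    refine le_trans ?_ (mul_le_mul_right hlen.le _)
    rw [Manifold.pathELength_eq_lintegral_mfderivWithin_Icc,
      Manifold.pathELength_eq_lintegral_mfderivWithin_Icc,
      ← lintegral_const_mul' _ _ ENNReal.coe_ne_top]
    refine setLIntegral_mono' measurableSet_Icc fun t ht ↦ ?_
    have hd : mfderivWithin 𝓘(ℝ, ℝ) J (s ∘ γ) (Icc 0 1) t =
        (mfderiv I J s (γ t)).comp (mfderivWithin 𝓘(ℝ, ℝ) I γ (Icc 0 1) t) := by
      apply mfderiv_comp_mfderivWithin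
      · exact (hs.contMDiffAt (mem_interior_iff_mem_nhds.1 (hmem t ht))).mdifferentiableAt
          one_ne_zero
      · exact hγ.mdifferentiableOn one_ne_zero t ht
      · rw [uniqueMDiffWithinAt_iff_uniqueDiffWithinAt]
        exact uniqueDiffOn_Icc zero_lt_one t ht
    rw [hd]
    exact hC _ (interior_subset (hmem t ht)) _
  have hne : (𝓝[>] edist y z).NeBot := nhdsGT_neBot_of_exists_gt ⟨_, hyz⟩
  have ht : Tendsto (fun ρ : ℝ≥0∞ ↦ C * ρ) (𝓝[>] edist y z) (𝓝 (C * edist y z)) :=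
    ((ENNReal.continuous_const_mul ENNReal.coe_ne_top).tendsto _).mono_left nhdsWithin_le_nhds
  exact ge_of_tendsto ht (mem_of_superset (Ioo_mem_nhdsGT hyz) key)

end LipschitzEstimate

/-- On a finite cover of the support by small balls, pairs of points which are close to each other
are handled by the local Lipschitz constants, all others by the boundedness of `f`. -/
theorem LocallyLipschitz.exists_lipschitzWith_of_hasCompactSupport {X : Type*}
    [PseudoEMetricSpace X] {f : X → ℝ} (hf : LocallyLipschitz f) (hc : HasCompactSupport f) :
    ∃ K : ℝ≥0, LipschitzWith K f := by
  obtain ⟨A, hA⟩ : ∃ A : ℝ≥0, ∀ x, ‖f x‖ₑ ≤ A := by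
    obtain ⟨A, hA⟩ := hc.exists_bound_of_continuous hf.continuous
    refine ⟨A.toNNReal, fun x ↦ ?_⟩
    rw [enorm_le_coe, ← NNReal.coe_le_coe]
    exact (hA x).trans (Real.le_coe_toNNReal A)
  have key : ∀ x, ∃ C : ℝ≥0, ∃ r : ℝ≥0, 0 < r ∧ LipschitzOnWith C f (Metric.eball x (r + r)) := by
    intro x
    obtain ⟨C, t, ht, hC⟩ := hf x
    obtain ⟨ε, hε, hεt⟩ := EMetric.mem_nhds_iff.1 ht
    obtain ⟨r, hr, hrε⟩ := ENNReal.lt_iff_exists_nnreal_btwn.1 hε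
    refine ⟨C, r / 2, half_pos (by exact_mod_cast hr), hC.mono ?_⟩
    rw [← ENNReal.coe_add, add_halves]
    exact (Metric.eball_subset_eball hrε.le).trans hεt
  choose C r hr hC using key
  obtain ⟨t, -, ht⟩ := hc.isCompact.elim_nhds_subcover (fun x ↦ Metric.eball x (r x))
    fun x _ ↦ Metric.eball_mem_nhds _ (by simpa using hr x)
  refine ⟨∑ x ∈ t, (C x + 2 * A / r x), ?_⟩
  have main : ∀ x ∈ tsupport f, ∀ y,
      edist (f x) (f y) ≤ (∑ x ∈ t, (C x + 2 * A / r x) : ℝ≥0) * edist x y := by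
    intro x hx y
    obtain ⟨z, hz, hxz⟩ := mem_iUnion₂.1 (ht hx)
    have hle : C z + 2 * A / r z ≤ ∑ x ∈ t, (C x + 2 * A / r x) :=
      Finset.single_le_sum (f := fun x ↦ C x + 2 * A / r x) (fun _ _ ↦ by positivity) hz
    refine le_trans ?_ (mul_le_mul_left (ENNReal.coe_le_coe.2 hle) _)
    rw [Metric.mem_eball] at hxz
    rcases lt_or_ge (edist x y) (r z) with h | h
    · refine (hC z ?_ ?_).trans ?_
      · exact Metric.mem_eball.2 (hxz.trans_le le_self_add)
      · rw [Metric.mem_eball]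
        calc edist y z ≤ edist y x + edist x z := edist_triangle _ _ _
          _ < _ := by rw [edist_comm y x]; exact ENNReal.add_lt_add h hxz
      · gcongr; exact le_self_add
    · calc edist (f x) (f y) ≤ ‖f x‖ₑ + ‖f y‖ₑ := by
            rw [edist_eq_enorm_sub]; exact enorm_sub_le
        _ ≤ A + A := add_le_add (hA x) (hA y)
        _ = ((2 * A / r z : ℝ≥0) : ℝ≥0∞) * r z := by
            rw [← ENNReal.coe_mul, div_mul_cancel₀ _ (hr z).ne', two_mul, ENNReal.coe_add]
        _ ≤ _ := by gcongr; exact le_add_self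
  intro x y
  by_cases hx : x ∈ tsupport f
  · exact main x hx y
  by_cases hy : y ∈ tsupport f
  · rw [edist_comm, edist_comm x y]; exact main y hy x
  · simp [image_eq_zero_of_notMem_tsupport hx, image_eq_zero_of_notMem_tsupport hy]

/-! ### Gradients in charts -/

section Gradient

theorem isContinuousRiemannianBundle_of_isContMDiffRiemannianBundle {E : Type*}
    [NormedAddCommGroup E] [NormedSpace ℝ E] {H : Type*} [TopologicalSpace H]
    (I : ModelWithCorners ℝ E H) (M : Type*) [TopologicalSpace M] [ChartedSpace H M]
    [IsManifold I 1 M] [RiemannianBundle (fun x : M ↦ TangentSpace I x)]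
    [h : IsContMDiffRiemannianBundle I ∞ E (fun x : M ↦ TangentSpace I x)] :
    IsContinuousRiemannianBundle E (fun x : M ↦ TangentSpace I x) := by
  obtain ⟨g, hg, hg'⟩ := h.exists_contMDiff
  exact ⟨g, hg.continuous, hg'⟩

variable {n : ℕ} {M₀ : Type*} [EMetricSpace M₀] [ChartedSpace (EuclideanSpace ℝ (Fin n)) M₀]

/-- The fibers of the tangent bundle are all the model space by definition, which allows to compare
vectors at `x` and at `x'` without a cast. The same is done for the norm and the inner product
below. -/
theorem differentialAt_congr (f : M₀ → ℝ) {x x' : M₀} (h : x = x')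
    (v : EuclideanSpace ℝ (Fin n)) : differentialAt n f x v = differentialAt n f x' v := by
  subst h; rfl

section Manifold

variable [IsManifold (𝓡 n) ∞ M₀]

theorem mdifferentiableAt_iff_differentiableAt_comp_extChartAt_symm (x₀ : M₀) {f : M₀ → ℝ} {x : M₀}
    (hx : x ∈ (extChartAt (𝓡 n) x₀).source) :
    MDifferentiableAt (𝓡 n) 𝓘(ℝ, ℝ) f x ↔
      DifferentiableAt ℝ (f ∘ (extChartAt (𝓡 n) x₀).symm) (extChartAt (𝓡 n) x₀ x) := by
  rw [← mdifferentiableAt_iff_differentiableAt]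
  constructor
  · intro hf
    have h1 : MDifferentiableAt (𝓡 n) (𝓡 n) (extChartAt (𝓡 n) x₀).symm
        (extChartAt (𝓡 n) x₀ x) := by
      have := mdifferentiableWithinAt_extChartAt_symm ((extChartAt (𝓡 n) x₀).map_source hx)
      rwa [ModelWithCorners.range_eq_univ, mdifferentiableWithinAt_univ] at this
    exact MDifferentiableAt.comp_of_eq _ hf h1 ((extChartAt (𝓡 n) x₀).left_inv hx)
  · intro hf
    have h1 : MDifferentiableAt (𝓡 n) (𝓡 n) (extChartAt (𝓡 n) x₀) x :=
      mdifferentiableAt_extChartAt (by simpa using hx)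
    refine (hf.comp x h1).congr_of_eventuallyEq ?_
    filter_upwards [(isOpen_extChartAt_source (I := 𝓡 n) x₀).mem_nhds hx] with z hz
    simp only [Function.comp_apply]
    rw [(extChartAt (𝓡 n) x₀).left_inv hz]

/-- No differentiability is required, as both sides vanish where `f` is not differentiable. -/
theorem fderiv_comp_extChartAt_symm (x₀ : M₀) (f : M₀ → ℝ) {y : EuclideanSpace ℝ (Fin n)}
    (hy : y ∈ (extChartAt (𝓡 n) x₀).target) (v : EuclideanSpace ℝ (Fin n)) :
    fderiv ℝ (f ∘ (extChartAt (𝓡 n) x₀).symm) y v =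
      differentialAt n f ((extChartAt (𝓡 n) x₀).symm y)
        (mfderiv (𝓡 n) (𝓡 n) (extChartAt (𝓡 n) x₀).symm y v) := by
  have hx := (extChartAt (𝓡 n) x₀).map_target hy
  have h1 : MDifferentiableAt (𝓡 n) (𝓡 n) (extChartAt (𝓡 n) x₀).symm y := by
    have := mdifferentiableWithinAt_extChartAt_symm hy
    rwa [ModelWithCorners.range_eq_univ, mdifferentiableWithinAt_univ] at this
  have hiff := mdifferentiableAt_iff_differentiableAt_comp_extChartAt_symm x₀ (f := f) hx
  rw [(extChartAt (𝓡 n) x₀).right_inv hy] at hiff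
  by_cases hf : MDifferentiableAt (𝓡 n) 𝓘(ℝ, ℝ) f ((extChartAt (𝓡 n) x₀).symm y)
  · have h2 := mfderiv_comp y hf h1
    rw [mfderiv_eq_fderiv] at h2
    exact congr($h2 v)
  · rw [differentialAt, mfderiv_zero_of_not_mdifferentiableAt hf,
      fderiv_zero_of_not_differentiableAt fun h ↦ hf (hiff.2 h)]
    rfl

theorem differentialAt_eq_fderiv (x₀ : M₀) (f : M₀ → ℝ) {x : M₀}
    (hx : x ∈ (extChartAt (𝓡 n) x₀).source) (w : TangentSpace (𝓡 n) x) :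
    differentialAt n f x w = fderiv ℝ (f ∘ (extChartAt (𝓡 n) x₀).symm) (extChartAt (𝓡 n) x₀ x)
      (mfderiv (𝓡 n) (𝓡 n) (extChartAt (𝓡 n) x₀) x w) := by
  have hinv := mfderivWithin_extChartAt_symm_comp_mfderiv_extChartAt' (I := 𝓡 n) hx
  rw [ModelWithCorners.range_eq_univ, mfderivWithin_univ] at hinv
  have hw : mfderiv (𝓡 n) (𝓡 n) (extChartAt (𝓡 n) x₀).symm (extChartAt (𝓡 n) x₀ x)
      (mfderiv (𝓡 n) (𝓡 n) (extChartAt (𝓡 n) x₀) x w) = w := congr($hinv w)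
  have h := fderiv_comp_extChartAt_symm x₀ f ((extChartAt (𝓡 n) x₀).map_source hx)
    (mfderiv (𝓡 n) (𝓡 n) (extChartAt (𝓡 n) x₀) x w)
  rw [hw] at h
  exact (h.trans (differentialAt_congr f ((extChartAt (𝓡 n) x₀).left_inv hx) w)).symm

end Manifold

variable [RiemannianBundle (fun x : M₀ ↦ TangentSpace (𝓡 n) x)]

theorem norm_tangentSpace_congr {x x' : M₀} (h : x = x') (v : EuclideanSpace ℝ (Fin n)) :
    norm (E := TangentSpace (𝓡 n) x) v = norm (E := TangentSpace (𝓡 n) x') v := by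
  subst h; rfl

theorem inner_tangentSpace_congr {x x' : M₀} (h : x = x') (v w : EuclideanSpace ℝ (Fin n)) :
    inner (E := TangentSpace (𝓡 n) x) ℝ v w = inner (E := TangentSpace (𝓡 n) x') ℝ v w := by
  subst h; rfl

theorem norm_riemannianGradient (f : M₀ → ℝ) (x : M₀) :
    ‖riemannianGradient n f x‖ = ‖differentialAt n f x‖ := by
  unfold riemannianGradient
  exact LinearIsometryEquiv.norm_map _ _

theorem norm_riemannianGradient_eq_zero_of_notMem_tsupport {f : M₀ → ℝ} {x : M₀}
    (hx : x ∉ tsupport f) : ‖riemannianGradient n f x‖ = 0 := by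
  have h0 : f =ᶠ[𝓝 x] fun _ ↦ 0 := notMem_tsupport_iff_eventuallyEq.1 hx
  have h : differentialAt n f x = 0 := by
    rw [differentialAt, h0.mfderiv_eq, mfderiv_const]
    rfl
  rw [norm_riemannianGradient, h]
  exact norm_zero (E := TangentSpace (𝓡 n) x →L[ℝ] ℝ)

variable [IsManifold (𝓡 n) ∞ M₀]

/-- A bound for the norm of the gradient can be tested on the coordinate fields of a dense sequence
of constant vectors. This makes the norm of the gradient measurable. -/
theorem norm_riemannianGradient_le_iff (x₀ : M₀) (f : M₀ → ℝ) {y : EuclideanSpace ℝ (Fin n)}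
    (hy : y ∈ (extChartAt (𝓡 n) x₀).target) {c : ℝ} (hc : 0 ≤ c) :
    ‖riemannianGradient n f ((extChartAt (𝓡 n) x₀).symm y)‖ ≤ c ↔
      ∀ k : ℕ, |fderiv ℝ (f ∘ (extChartAt (𝓡 n) x₀).symm) y
          (TopologicalSpace.denseSeq (EuclideanSpace ℝ (Fin n)) k)| ≤
        c * norm (E := TangentSpace (𝓡 n) ((extChartAt (𝓡 n) x₀).symm y))
          (mfderiv (𝓡 n) (𝓡 n) (extChartAt (𝓡 n) x₀).symm y
            (TopologicalSpace.denseSeq (EuclideanSpace ℝ (Fin n)) k)) := by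
  let D : EuclideanSpace ℝ (Fin n) →L[ℝ] TangentSpace (𝓡 n) ((extChartAt (𝓡 n) x₀).symm y) :=
    mfderiv (𝓡 n) (𝓡 n) (extChartAt (𝓡 n) x₀).symm y
  have hD : Function.Surjective D := by
    have := isInvertible_mfderivWithin_extChartAt_symm (I := 𝓡 n) hy
    rw [ModelWithCorners.range_eq_univ, mfderivWithin_univ] at this
    exact this.bijective.surjective
  rw [norm_riemannianGradient]
  constructor
  · intro h k
    rw [fderiv_comp_extChartAt_symm x₀ f hy]
    exact (differentialAt n f _).le_of_opNorm_le h _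
  · intro h
    refine ContinuousLinearMap.opNorm_le_bound _ hc fun w ↦ ?_
    obtain ⟨v, rfl⟩ := hD w
    have hclosed : IsClosed {v : EuclideanSpace ℝ (Fin n) |
        |fderiv ℝ (f ∘ (extChartAt (𝓡 n) x₀).symm) y v| ≤ c * ‖D v‖} :=
      isClosed_le (by fun_prop) (by fun_prop)
    have hall := hclosed.closure_subset_iff.2 (range_subset_iff.2 h)
      (TopologicalSpace.denseRange_denseSeq _ v)
    have h3 := fderiv_comp_extChartAt_symm x₀ f hy v
    rw [Real.norm_eq_abs]
    exact (congr(|$h3|)).symm.le.trans hall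

variable [IsContMDiffRiemannianBundle (𝓡 n) ∞ (EuclideanSpace ℝ (Fin n))
    (fun x : M₀ ↦ TangentSpace (𝓡 n) x)]

theorem continuousOn_inner_mfderiv_extChartAt_symm (x₀ : M₀) (v w : EuclideanSpace ℝ (Fin n)) :
    ContinuousOn (fun y ↦ (inner ℝ
      (mfderiv (𝓡 n) (𝓡 n) (extChartAt (𝓡 n) x₀).symm y v :
        TangentSpace (𝓡 n) ((extChartAt (𝓡 n) x₀).symm y))
      (mfderiv (𝓡 n) (𝓡 n) (extChartAt (𝓡 n) x₀).symm y w) : ℝ)) (extChartAt (𝓡 n) x₀).target := by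
  have key : ∀ v : EuclideanSpace ℝ (Fin n), ContinuousOn (fun y ↦
     (⟨(extChartAt (𝓡 n) x₀).symm y, mfderiv (𝓡 n) (𝓡 n) (extChartAt (𝓡 n) x₀).symm y v⟩ :
      TangentBundle (𝓡 n) M₀)) (extChartAt (𝓡 n) x₀).target := by
    intro v
    have h1 := ContMDiffOn.continuousOn_tangentMapWithin
      (contMDiffOn_extChartAt_symm (n := ∞) (I := 𝓡 n) x₀) (by simp)
      (isOpen_extChartAt_target (I := 𝓡 n) x₀).uniqueMDiffOn
    have h2 : Continuous fun y : EuclideanSpace ℝ (Fin n) ↦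
        (⟨y, v⟩ : TangentBundle (𝓡 n) (EuclideanSpace ℝ (Fin n))) :=
      (tangentBundleModelSpaceHomeomorph (𝓡 n)).symm.continuous.comp (Continuous.prodMk_left v)
    refine (h1.comp h2.continuousOn fun y hy ↦ hy).congr fun y hy ↦ ?_
    have hy' : y ∈ (extChartAt (𝓡 n) x₀).target := hy
    simp only [Function.comp_apply, tangentMapWithin,
      mfderivWithin_of_isOpen (isOpen_extChartAt_target (I := 𝓡 n) x₀) hy']
  have := isContinuousRiemannianBundle_of_isContMDiffRiemannianBundle (𝓡 n) M₀
  exact (key v).inner_bundle (key w)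

theorem exists_lipschitzOnWith_extChartAt_symm [IsRiemannianManifold (𝓡 n) M₀] (x₀ : M₀) :
    ∃ C : ℝ≥0, ∃ W ∈ 𝓝 (extChartAt (𝓡 n) x₀ x₀),
      LipschitzOnWith C (extChartAt (𝓡 n) x₀).symm W := by
  have := isContinuousRiemannianBundle_of_isContMDiffRiemannianBundle (𝓡 n) M₀
  obtain ⟨C, hC0, hC⟩ := eventually_norm_mfderivWithin_symm_extChartAt_lt (𝓡 n) x₀
  rw [ModelWithCorners.range_eq_univ, nhdsWithin_univ] at hC
  obtain ⟨U, hU, hUC⟩ := hC.exists_mem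
  refine ⟨C.toNNReal, exists_lipschitzOnWith_of_enorm_mfderiv_le (I := 𝓡 n) (J := 𝓡 n)
    (inter_mem (extChartAt_target_mem_nhds x₀) hU)
    ((contMDiffOn_extChartAt_symm x₀).mono inter_subset_left) fun y hy v ↦ ?_⟩
  have h := hUC y hy.2
  rw [mfderivWithin_univ] at h
  -- the operator norm refers to the norm of the model space on the source
  let D : EuclideanSpace ℝ (Fin n) →L[ℝ] TangentSpace (𝓡 n) ((extChartAt (𝓡 n) x₀).symm y) :=
    mfderiv (𝓡 n) (𝓡 n) (extChartAt (𝓡 n) x₀).symm y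
  have hD : ‖D‖ < C := h
  have h2 := D.le_of_opNorm_le hD.le v
  rw [← ofReal_norm, ← ofReal_norm, norm_tangentSpace_vectorSpace,
    show (C.toNNReal : ℝ≥0∞) = ENNReal.ofReal C from rfl, ← ENNReal.ofReal_mul hC0.le]
  exact ENNReal.ofReal_le_ofReal h2

/-- The norm of the gradient of a Lipschitz function is locally bounded. -/
theorem LipschitzWith.exists_norm_riemannianGradient_le
    [IsRiemannianManifold (𝓡 n) M₀] {K : ℝ≥0} {f : M₀ → ℝ} (hf : LipschitzWith K f) (x₀ : M₀) :
    ∃ C : ℝ, ∀ᶠ x in 𝓝 x₀, ‖riemannianGradient n f x‖ ≤ C := by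
  have := isContinuousRiemannianBundle_of_isContMDiffRiemannianBundle (𝓡 n) M₀
  obtain ⟨C, W, hW, hLip⟩ := exists_lipschitzOnWith_extChartAt_symm (n := n) x₀
  obtain ⟨C', hC'0, hC'⟩ := eventually_norm_mfderiv_extChartAt_lt (𝓡 n) x₀
  refine ⟨(K * C : ℝ≥0) * C', ?_⟩
  have hW' : ∀ᶠ x in 𝓝 x₀, extChartAt (𝓡 n) x₀ x ∈ interior W :=
    (continuousAt_extChartAt x₀).preimage_mem_nhds (interior_mem_nhds.2 hW)
  filter_upwards [hC', hW', extChartAt_source_mem_nhds (I := 𝓡 n) x₀] with x hx hxW hxs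
  have hF : LipschitzOnWith (K * C) (f ∘ (extChartAt (𝓡 n) x₀).symm) W :=
    hf.comp_lipschitzOnWith hLip
  have hfd := norm_fderiv_le_of_lipschitzOn ℝ (mem_interior_iff_mem_nhds.1 hxW) hF
  rw [norm_riemannianGradient]
  refine ContinuousLinearMap.opNorm_le_bound _ (by positivity) fun w ↦ ?_
  let D : TangentSpace (𝓡 n) x →L[ℝ] EuclideanSpace ℝ (Fin n) :=
    mfderiv (𝓡 n) (𝓡 n) (extChartAt (𝓡 n) x₀) x
  have hDC : ‖D‖ < C' := hx
  rw [differentialAt_eq_fderiv x₀ f hxs]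
  calc _ ≤ (K * C : ℝ≥0) * ‖D w‖ := ContinuousLinearMap.le_of_opNorm_le _ hfd _
    _ ≤ (K * C : ℝ≥0) * (C' * ‖w‖) := by
        gcongr
        exact D.le_of_opNorm_le hDC.le w
    _ = _ := by ring

end Gradient

/-! ### Isometries between open subsets -/

section PartialIsometry

variable {n : ℕ} {M₀ M₁ : Type*} [EMetricSpace M₀] [ChartedSpace (EuclideanSpace ℝ (Fin n)) M₀]
  [RiemannianBundle (fun x : M₀ ↦ TangentSpace (𝓡 n) x)]
  [EMetricSpace M₁] [ChartedSpace (EuclideanSpace ℝ (Fin n)) M₁]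
  [RiemannianBundle (fun x : M₁ ↦ TangentSpace (𝓡 n) x)]

variable (n) in
/-- A smooth Riemannian isometry between open subsets of two Riemannian manifolds, as a property
of the underlying partial homeomorphism. -/
structure IsPartialIsometry (e : OpenPartialHomeomorph M₁ M₀) : Prop where
  contMDiffOn : ContMDiffOn (𝓡 n) (𝓡 n) ∞ e e.source
  inner_mfderiv : ∀ y ∈ e.source, ∀ v w : TangentSpace (𝓡 n) y,
    inner ℝ (mfderiv (𝓡 n) (𝓡 n) e y v) (mfderiv (𝓡 n) (𝓡 n) e y w) = inner ℝ v w

namespace IsPartialIsometry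

theorem refl : IsPartialIsometry n (OpenPartialHomeomorph.refl M₁) where
  contMDiffOn := contMDiffOn_id
  inner_mfderiv y _ v w := by
    have h : mfderiv (𝓡 n) (𝓡 n) (OpenPartialHomeomorph.refl M₁) y =
        ContinuousLinearMap.id ℝ (TangentSpace (𝓡 n) y) := mfderiv_id
    rw [h]
    rfl

variable {e : OpenPartialHomeomorph M₁ M₀}

theorem contMDiffAt (he : IsPartialIsometry n e) {y : M₁} (hy : y ∈ e.source) :
    ContMDiffAt (𝓡 n) (𝓡 n) ∞ e y :=
  he.contMDiffOn.contMDiffAt (e.open_source.mem_nhds hy)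

theorem mdifferentiableAt (he : IsPartialIsometry n e) {y : M₁} (hy : y ∈ e.source) :
    MDifferentiableAt (𝓡 n) (𝓡 n) e y :=
  (he.contMDiffAt hy).mdifferentiableAt (by simp)

theorem norm_mfderiv (he : IsPartialIsometry n e) {y : M₁} (hy : y ∈ e.source)
    (v : TangentSpace (𝓡 n) y) : ‖mfderiv (𝓡 n) (𝓡 n) e y v‖ = ‖v‖ := by
  rw [norm_eq_sqrt_real_inner, he.inner_mfderiv y hy, ← norm_eq_sqrt_real_inner]

theorem injective_mfderiv (he : IsPartialIsometry n e) {y : M₁} (hy : y ∈ e.source) :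
    Function.Injective (mfderiv (𝓡 n) (𝓡 n) e y) :=
  (injective_iff_map_eq_zero _).2 fun v hv ↦ norm_eq_zero.1 <| by
    rw [← he.norm_mfderiv hy, hv, norm_zero]

/-- The inverse function theorem, applied to the expression of `e` in the charts at `y` and
`e y`. -/
theorem contMDiffAt_symm_apply [IsManifold (𝓡 n) ∞ M₀] [IsManifold (𝓡 n) ∞ M₁]
    (he : IsPartialIsometry n e) {y : M₁} (hy : y ∈ e.source) :
    ContMDiffAt (𝓡 n) (𝓡 n) ∞ e.symm (e y) := by
  let A : EuclideanSpace ℝ (Fin n) →L[ℝ] EuclideanSpace ℝ (Fin n) := mfderiv (𝓡 n) (𝓡 n) e y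
  have hA : Function.Injective A := he.injective_mfderiv hy
  let A' : EuclideanSpace ℝ (Fin n) ≃L[ℝ] EuclideanSpace ℝ (Fin n) :=
    (LinearEquiv.ofInjectiveEndo A.toLinearMap hA).toContinuousLinearEquiv
  have hAA' : (A' : EuclideanSpace ℝ (Fin n) →L[ℝ] EuclideanSpace ℝ (Fin n)) = A := by
    ext v; rfl
  let T := (chartAt (EuclideanSpace ℝ (Fin n)) y).symm ≫ₕ e ≫ₕ
    chartAt (EuclideanSpace ℝ (Fin n)) (e y)
  have hTd : HasFDerivAt T (A' : EuclideanSpace ℝ (Fin n) →L[ℝ] EuclideanSpace ℝ (Fin n))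
      (chartAt (EuclideanSpace ℝ (Fin n)) y y) := by
    rw [hAA', ← hasFDerivWithinAt_univ]
    have : HasFDerivWithinAt (writtenInExtChartAt (𝓡 n) (𝓡 n) y e) A (range (𝓡 n))
      (extChartAt (𝓡 n) y y) := (he.mdifferentiableAt hy).hasMFDerivAt.2
    rw [ModelWithCorners.range_eq_univ] at this
    simpa [-hasFDerivWithinAt_univ, writtenInExtChartAt, T, Function.comp_def] using this
  have hTc : ContDiffAt ℝ ∞ T (chartAt (EuclideanSpace ℝ (Fin n)) y y) := by
    rw [← contDiffWithinAt_univ]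
    have := (contMDiffAt_iff.1 (he.contMDiffAt hy)).2
    simpa [T, Function.comp_def] using this
  have hTy : T (chartAt (EuclideanSpace ℝ (Fin n)) y y) =
      chartAt (EuclideanSpace ℝ (Fin n)) (e y) (e y) := by simp [T]
  have hmem : chartAt (EuclideanSpace ℝ (Fin n)) (e y) (e y) ∈ T.target := by
    simp [T, hy]
  have hTs : T.symm (chartAt (EuclideanSpace ℝ (Fin n)) (e y) (e y)) =
      chartAt (EuclideanSpace ℝ (Fin n)) y y := by
    simp [T, hy]
  have := T.contDiffAt_symm hmem (hTs.symm ▸ hTd) (hTs.symm ▸ hTc)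
  rw [← contDiffWithinAt_univ] at this
  rw [contMDiffAt_iff]
  refine ⟨e.continuousAt_symm (e.map_source hy), ?_⟩
  simpa [T, Function.comp_def, hy] using this

section Manifold

variable [IsManifold (𝓡 n) ∞ M₀] [IsManifold (𝓡 n) ∞ M₁]

theorem contMDiffOn_symm (he : IsPartialIsometry n e) :
    ContMDiffOn (𝓡 n) (𝓡 n) ∞ e.symm e.target := by
  intro x hx
  have := he.contMDiffAt_symm_apply (e.map_target hx)
  rw [e.right_inv hx] at this
  exact this.contMDiffWithinAt

theorem mdifferentiableAt_symm (he : IsPartialIsometry n e) {x : M₀} (hx : x ∈ e.target) :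
    MDifferentiableAt (𝓡 n) (𝓡 n) e.symm x :=
  (he.contMDiffOn_symm.contMDiffAt (e.open_target.mem_nhds hx)).mdifferentiableAt (by simp)

theorem mfderiv_mfderiv_symm (he : IsPartialIsometry n e) {x : M₀} (hx : x ∈ e.target)
    (v : TangentSpace (𝓡 n) x) :
    mfderiv (𝓡 n) (𝓡 n) e (e.symm x) (mfderiv (𝓡 n) (𝓡 n) e.symm x v) = v := by
  have h := mfderiv_comp x (he.mdifferentiableAt (e.map_target hx)) (he.mdifferentiableAt_symm hx)
  have h' : mfderiv (𝓡 n) (𝓡 n) (e ∘ e.symm) x = mfderiv (𝓡 n) (𝓡 n) id x :=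
    Filter.EventuallyEq.mfderiv_eq (e.eventually_right_inverse hx)
  rw [h', mfderiv_id] at h
  exact (congr($h v)).symm

theorem norm_mfderiv_symm (he : IsPartialIsometry n e) {x : M₀} (hx : x ∈ e.target)
    (v : TangentSpace (𝓡 n) x) : ‖mfderiv (𝓡 n) (𝓡 n) e.symm x v‖ = ‖v‖ := by
  rw [← he.norm_mfderiv (e.map_target hx), he.mfderiv_mfderiv_symm hx]
  exact norm_tangentSpace_congr (e.right_inv hx) v

theorem exists_lipschitzOnWith_symm [IsRiemannianManifold (𝓡 n) M₀]
    [IsRiemannianManifold (𝓡 n) M₁] (he : IsPartialIsometry n e) {x : M₀} (hx : x ∈ e.target) :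
    ∃ W ∈ 𝓝 x, LipschitzOnWith 1 e.symm W := by
  refine exists_lipschitzOnWith_of_enorm_mfderiv_le (I := 𝓡 n) (J := 𝓡 n)
    (e.open_target.mem_nhds hx) (he.contMDiffOn_symm.of_le (by simp)) fun y hy v ↦ ?_
  rw [ENNReal.coe_one, one_mul, ← ofReal_norm, ← ofReal_norm, he.norm_mfderiv_symm hy]

end Manifold

end IsPartialIsometry

end PartialIsometry

/-! ### The Riemannian volume -/

/-- The transformation rule of Gram determinants under an endomorphism `L`. -/
theorem det_of_inner_comp {ι E V : Type*} [Fintype ι] [DecidableEq ι] [AddCommGroup E] [Module ℝ E]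
    [NormedAddCommGroup V] [InnerProductSpace ℝ V] (b : Module.Basis ι ℝ E) (L : E →ₗ[ℝ] E)
    (Φ : E →ₗ[ℝ] V) :
    Matrix.det (Matrix.of fun i j ↦ inner ℝ (Φ (L (b i))) (Φ (L (b j)))) =
      LinearMap.det L ^ 2 * Matrix.det (Matrix.of fun i j ↦ inner ℝ (Φ (b i)) (Φ (b j))) := by
  set A := LinearMap.toMatrix b b L with hA
  have hL : ∀ i, L (b i) = ∑ k, A k i • b k := fun i ↦ by
    simp only [hA, LinearMap.toMatrix_apply]
    exact (b.sum_repr _).symm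
  have : (Matrix.of fun i j ↦ inner ℝ (Φ (L (b i))) (Φ (L (b j)))) =
      A.transpose * (Matrix.of fun i j ↦ inner ℝ (Φ (b i)) (Φ (b j))) * A := by
    ext i j
    simp only [Matrix.of_apply, Matrix.mul_apply, Matrix.transpose_apply, hL, map_sum, map_smul,
      sum_inner, inner_sum, real_inner_smul_left, real_inner_smul_right, Finset.sum_mul]
    refine Finset.sum_congr rfl fun k _ ↦ Finset.sum_congr rfl fun l _ ↦ ?_
    rw [real_inner_comm]
    ring
  rw [this, Matrix.det_mul, Matrix.det_mul, Matrix.det_transpose, hA, LinearMap.det_toMatrix]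
  ring

theorem ContinuousOn.measurableSet_inter_preimage {X Y : Type*} [TopologicalSpace X]
    [MeasurableSpace X] [OpensMeasurableSpace X] [TopologicalSpace Y] [MeasurableSpace Y]
    [BorelSpace Y] {f : X → Y} {s : Set X} {t : Set Y} (hf : ContinuousOn f s)
    (hs : MeasurableSet s) (ht : MeasurableSet t) : MeasurableSet (s ∩ f ⁻¹' t) := by
  have h := hs.subtype_image ((continuousOn_iff_continuous_domRestrict.1 hf).measurable ht)
  convert! h using 1
  ext x
  simp [and_comm]

section Volume

variable {n : ℕ} {M₀ M₁ : Type*} [EMetricSpace M₀] [ChartedSpace (EuclideanSpace ℝ (Fin n)) M₀]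
  [RiemannianBundle (fun x : M₀ ↦ TangentSpace (𝓡 n) x)]
  [EMetricSpace M₁] [ChartedSpace (EuclideanSpace ℝ (Fin n)) M₁]
  [RiemannianBundle (fun x : M₁ ↦ TangentSpace (𝓡 n) x)]

section Chart

variable [MeasurableSpace M₀] [BorelSpace M₀]

theorem chartVolume_apply (x₀ : M₀) {A : Set M₀} (hA : MeasurableSet A) :
    chartVolume n x₀ A = ∫⁻ y in (extChartAt (𝓡 n) x₀).target ∩ (extChartAt (𝓡 n) x₀).symm ⁻¹' A,
      ENNReal.ofReal (chartDensity n x₀ y) := by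
  have ht : MeasurableSet (extChartAt (𝓡 n) x₀).target :=
    (isOpen_extChartAt_target (I := 𝓡 n) x₀).measurableSet
  have hm : AEMeasurable (extChartAt (𝓡 n) x₀).symm
      ((volume.restrict (extChartAt (𝓡 n) x₀).target).withDensity
        fun y ↦ ENNReal.ofReal (chartDensity n x₀ y)) :=
    ((continuousOn_extChartAt_symm x₀).aemeasurable ht).mono_ac
      (withDensity_absolutelyContinuous _ _)
  rw [chartVolume, Measure.map_apply_of_aemeasurable hm hA, withDensity_apply',
    Measure.restrict_restrict' ht, inter_comm]

theorem chartVolume_eq_zero_of_disjoint (x₀ : M₀) {A : Set M₀} (hA : MeasurableSet A)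
    (h : Disjoint A (extChartAt (𝓡 n) x₀).source) : chartVolume n x₀ A = 0 := by
  have : (extChartAt (𝓡 n) x₀).target ∩ (extChartAt (𝓡 n) x₀).symm ⁻¹' A = ∅ := by
    ext y
    simp only [mem_inter_iff, mem_preimage, mem_empty_iff_false, iff_false, not_and]
    exact fun hy hyA ↦ h.notMem_of_mem_left hyA ((extChartAt (𝓡 n) x₀).map_target hy)
  rw [chartVolume_apply x₀ hA, this, setLIntegral_empty]

end Chart

variable [IsManifold (𝓡 n) ∞ M₀]

theorem continuousOn_chartDensity
    [IsContMDiffRiemannianBundle (𝓡 n) ∞ (EuclideanSpace ℝ (Fin n))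
      (fun x : M₀ ↦ TangentSpace (𝓡 n) x)] (x₀ : M₀) :
    ContinuousOn (chartDensity n x₀) (extChartAt (𝓡 n) x₀).target := by
  refine Real.continuous_sqrt.comp_continuousOn ?_
  rw [continuousOn_iff_continuous_domRestrict]
  refine Continuous.matrix_det (continuous_matrix fun i j ↦ ?_)
  exact continuousOn_iff_continuous_domRestrict.1
    (continuousOn_inner_mfderiv_extChartAt_symm x₀ (EuclideanSpace.single i 1)
      (EuclideanSpace.single j 1))

section Isometry

variable [IsManifold (𝓡 n) ∞ M₁]

/-- The densities of the volume in two charts which correspond under an isometry differ by the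
Jacobian of the coordinate change, because Gram determinants change by the square of the
determinant. -/
theorem IsPartialIsometry.hasFDerivAt_chart {e : OpenPartialHomeomorph M₁ M₀}
    (he : IsPartialIsometry n e) (y₀ : M₁) (x₀ : M₀) {y : EuclideanSpace ℝ (Fin n)}
    (hy : y ∈ (extChartAt (𝓡 n) y₀).target) (hys : (extChartAt (𝓡 n) y₀).symm y ∈ e.source)
    (hyx : e ((extChartAt (𝓡 n) y₀).symm y) ∈ (extChartAt (𝓡 n) x₀).source) :
    ∃ L : EuclideanSpace ℝ (Fin n) →L[ℝ] EuclideanSpace ℝ (Fin n),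
      HasFDerivAt (extChartAt (𝓡 n) x₀ ∘ e ∘ (extChartAt (𝓡 n) y₀).symm) L y ∧
      chartDensity n y₀ y = |L.det| * chartDensity n x₀
        ((extChartAt (𝓡 n) x₀ ∘ e ∘ (extChartAt (𝓡 n) y₀).symm) y) := by
  set φ := extChartAt (𝓡 n) y₀
  set ψ := extChartAt (𝓡 n) x₀ with hψ
  have h1 : MDifferentiableAt (𝓡 n) (𝓡 n) φ.symm y := by
    have := mdifferentiableWithinAt_extChartAt_symm hy
    rwa [ModelWithCorners.range_eq_univ, mdifferentiableWithinAt_univ] at this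
  have h2 := he.mdifferentiableAt hys
  have h3 : MDifferentiableAt (𝓡 n) (𝓡 n) ψ (e (φ.symm y)) :=
    mdifferentiableAt_extChartAt (by simpa [hψ] using hyx)
  have hT : MDifferentiableAt (𝓡 n) (𝓡 n) (ψ ∘ e ∘ φ.symm) y :=
    h3.comp y (h2.comp y h1)
  obtain ⟨L, hL⟩ : ∃ L : EuclideanSpace ℝ (Fin n) →L[ℝ] EuclideanSpace ℝ (Fin n),
    HasFDerivAt (ψ ∘ e ∘ φ.symm) L y := ⟨_, hT.differentiableAt.hasFDerivAt⟩
  refine ⟨L, hL, ?_⟩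
  have hTy : (ψ ∘ e ∘ φ.symm) y ∈ ψ.target := ψ.map_source hyx
  have hψT : ψ.symm ((ψ ∘ e ∘ φ.symm) y) = e (φ.symm y) := ψ.left_inv hyx
  have h4 : MDifferentiableAt (𝓡 n) (𝓡 n) ψ.symm ((ψ ∘ e ∘ φ.symm) y) := by
    have := mdifferentiableWithinAt_extChartAt_symm hTy
    rwa [ModelWithCorners.range_eq_univ, mdifferentiableWithinAt_univ] at this
  have hev : ψ.symm ∘ (ψ ∘ e ∘ φ.symm) =ᶠ[𝓝 y] e ∘ φ.symm := by
    have hc : ContinuousAt (e ∘ φ.symm) y := (h2.comp y h1).continuousAt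
    filter_upwards [hc.preimage_mem_nhds ((isOpen_extChartAt_source (I := 𝓡 n) x₀).mem_nhds hyx)]
      with z hz
    exact ψ.left_inv hz
  have hd1 := mfderiv_comp y h2 h1
  have hd2 := mfderiv_comp y h4 hT
  rw [hev.mfderiv_eq, hd1] at hd2
  have hTL : mfderiv (𝓡 n) (𝓡 n) (ψ ∘ e ∘ φ.symm) y = L := hL.hasMFDerivAt.mfderiv
  rw [hTL] at hd2
  let b := (EuclideanSpace.basisFun (Fin n) ℝ).toBasis
  have hb : ∀ i, b i = EuclideanSpace.single i 1 := fun i ↦ by simp [b]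
  let Φ : EuclideanSpace ℝ (Fin n) →ₗ[ℝ] TangentSpace (𝓡 n) (ψ.symm ((ψ ∘ e ∘ φ.symm) y)) :=
    (mfderiv (𝓡 n) (𝓡 n) ψ.symm ((ψ ∘ e ∘ φ.symm) y)).toLinearMap
  have hv : ∀ i, mfderiv (𝓡 n) (𝓡 n) e (φ.symm y) (chartVector n y₀ y i) = Φ (L (b i)) :=
    fun i ↦ by
      rw [hb]
      exact congr($hd2 (EuclideanSpace.single i 1 : EuclideanSpace ℝ (Fin n)))
  have hG : ∀ i j, inner ℝ (chartVector n y₀ y i) (chartVector n y₀ y j) =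
      inner ℝ (Φ (L (b i))) (Φ (L (b j))) := by
    intro i j
    rw [← he.inner_mfderiv _ hys, hv, hv]
    exact inner_tangentSpace_congr hψT.symm _ _
  have hG₀ : ∀ i j, inner ℝ (chartVector n x₀ ((ψ ∘ e ∘ φ.symm) y) i)
      (chartVector n x₀ ((ψ ∘ e ∘ φ.symm) y) j) = inner ℝ (Φ (b i)) (Φ (b j)) := by
    intro i j
    rw [hb, hb]
    rfl
  simp only [chartDensity, hG, hG₀]
  have := det_of_inner_comp b L.toLinearMap Φ
  simp only [ContinuousLinearMap.coe_coe] at this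
  rw [this, Real.sqrt_mul (sq_nonneg _), Real.sqrt_sq_eq_abs]

variable [MeasurableSpace M₀] [BorelSpace M₀] [MeasurableSpace M₁] [BorelSpace M₁]

/-- Isometries preserve the measures `√(det (gᵢⱼ)) dy¹ ⋯ dyⁿ` of charts. This is the change of
variables formula for the coordinate expression of the isometry. -/
theorem IsPartialIsometry.chartVolume_eq {e : OpenPartialHomeomorph M₁ M₀}
    (he : IsPartialIsometry n e) (y₀ : M₁) (x₀ : M₀) {A : Set M₁} (hA : MeasurableSet A)
    (hAe : A ⊆ e.source) (hAy : A ⊆ (extChartAt (𝓡 n) y₀).source)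
    (hAx : MapsTo e A (extChartAt (𝓡 n) x₀).source) :
    chartVolume n y₀ A = chartVolume n x₀ (e.target ∩ e.symm ⁻¹' A) := by
  have hA' : MeasurableSet (e.target ∩ e.symm ⁻¹' A) :=
    e.continuousOn_symm.measurableSet_inter_preimage e.open_target.measurableSet hA
  rw [chartVolume_apply y₀ hA, chartVolume_apply x₀ hA']
  have hS : MeasurableSet ((extChartAt (𝓡 n) y₀).target ∩ (extChartAt (𝓡 n) y₀).symm ⁻¹' A) :=
    (continuousOn_extChartAt_symm y₀).measurableSet_inter_preimage
      (isOpen_extChartAt_target (I := 𝓡 n) y₀).measurableSet hA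
  have key : ∀ y : EuclideanSpace ℝ (Fin n),
      ∃ L : EuclideanSpace ℝ (Fin n) →L[ℝ] EuclideanSpace ℝ (Fin n),
      y ∈ (extChartAt (𝓡 n) y₀).target ∩ (extChartAt (𝓡 n) y₀).symm ⁻¹' A →
      HasFDerivAt (extChartAt (𝓡 n) x₀ ∘ e ∘ (extChartAt (𝓡 n) y₀).symm) L y ∧
      chartDensity n y₀ y = |L.det| * chartDensity n x₀
        ((extChartAt (𝓡 n) x₀ ∘ e ∘ (extChartAt (𝓡 n) y₀).symm) y) := by
    intro y
    by_cases hy : y ∈ (extChartAt (𝓡 n) y₀).target ∩ (extChartAt (𝓡 n) y₀).symm ⁻¹' A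
    · obtain ⟨L, hL⟩ := he.hasFDerivAt_chart y₀ x₀ hy.1 (hAe hy.2) (hAx hy.2)
      exact ⟨L, fun _ ↦ hL⟩
    · exact ⟨0, fun h ↦ absurd h hy⟩
  choose L hL using key
  have himage : (extChartAt (𝓡 n) x₀).target ∩
      (extChartAt (𝓡 n) x₀).symm ⁻¹' (e.target ∩ e.symm ⁻¹' A) =
      (extChartAt (𝓡 n) x₀ ∘ e ∘ (extChartAt (𝓡 n) y₀).symm) ''
        ((extChartAt (𝓡 n) y₀).target ∩ (extChartAt (𝓡 n) y₀).symm ⁻¹' A) := by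
    ext z
    constructor
    · rintro ⟨hz, hz1, hz2⟩
      have h1 := (extChartAt (𝓡 n) y₀).left_inv (hAy hz2)
      refine ⟨extChartAt (𝓡 n) y₀ (e.symm ((extChartAt (𝓡 n) x₀).symm z)),
        ⟨(extChartAt (𝓡 n) y₀).map_source (hAy hz2), ?_⟩, ?_⟩
      · rw [mem_preimage, h1]
        exact hz2
      · rw [Function.comp_apply, Function.comp_apply, h1, e.right_inv hz1,
          (extChartAt (𝓡 n) x₀).right_inv hz]
    · rintro ⟨y, ⟨hy, hyA⟩, rfl⟩
      have h1 := (extChartAt (𝓡 n) x₀).left_inv (hAx hyA)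
      refine ⟨(extChartAt (𝓡 n) x₀).map_source (hAx hyA), ?_⟩
      rw [mem_preimage, Function.comp_apply, Function.comp_apply, h1]
      refine ⟨e.map_source (hAe hyA), ?_⟩
      rw [mem_preimage, e.left_inv (hAe hyA)]
      exact hyA
  have hinj : InjOn (extChartAt (𝓡 n) x₀ ∘ e ∘ (extChartAt (𝓡 n) y₀).symm)
      ((extChartAt (𝓡 n) y₀).target ∩ (extChartAt (𝓡 n) y₀).symm ⁻¹' A) := by
    intro y hy z hz hyz
    have h1 := (extChartAt (𝓡 n) x₀).injOn (hAx hy.2) (hAx hz.2) hyz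
    exact (extChartAt (𝓡 n) y₀).symm.injOn hy.1 hz.1 (e.injOn (hAe hy.2) (hAe hz.2) h1)
  rw [himage, lintegral_image_eq_lintegral_abs_det_fderiv_mul volume hS
    (fun y hy ↦ (hL y hy).1.hasFDerivWithinAt) hinj]
  refine setLIntegral_congr_fun hS fun y hy ↦ ?_
  rw [(hL y hy).2, ENNReal.ofReal_mul (abs_nonneg _)]

end Isometry

variable [MeasurableSpace M₀] [BorelSpace M₀]

theorem chartVolume_eq_of_subset (x₀ x₁ : M₀) {A : Set M₀} (hA : MeasurableSet A)
    (hA₀ : A ⊆ (extChartAt (𝓡 n) x₀).source) (hA₁ : A ⊆ (extChartAt (𝓡 n) x₁).source) :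
    chartVolume n x₀ A = chartVolume n x₁ A := by
  have := (IsPartialIsometry.refl (n := n) (M₁ := M₀)).chartVolume_eq x₀ x₁ hA (subset_univ _) hA₀
    hA₁
  rw [this]
  congr 1
  exact univ_inter A

/-- The Riemannian volume restricts to the measure `√(det (gᵢⱼ)) dy¹ ⋯ dyⁿ` on each chart
domain. The volume is bounded from above by the measure glued from countably many chart measures
along a partition of `M₀`, which begins with the domain of the given chart. -/
theorem riemannianVolume_eq_chartVolume [SecondCountableTopology M₀] (x₀ : M₀) {A : Set M₀}
    (hA : MeasurableSet A) (hA₀ : A ⊆ (extChartAt (𝓡 n) x₀).source) :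
    riemannianVolume n M₀ A = chartVolume n x₀ A := by
  refine le_antisymm ?_ (le_iSup (chartVolume n (M := M₀)) x₀ A)
  obtain ⟨s, hs, hcov⟩ := TopologicalSpace.countable_cover_nhds
    fun x : M₀ ↦ extChartAt_source_mem_nhds (I := 𝓡 n) x
  have hne : s.Nonempty := by
    by_contra h
    rw [not_nonempty_iff_eq_empty] at h
    simp only [h, mem_empty_iff_false, iUnion_of_empty, iUnion_empty] at hcov
    exact (hcov ▸ mem_univ x₀ : x₀ ∈ (∅ : Set M₀))
  obtain ⟨f, rfl⟩ := hs.exists_eq_range hne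
  -- a sequence of charts covering `M₀` which starts with the chart at `x₀`
  let g : ℕ → M₀ := fun k ↦ Nat.casesOn k x₀ f
  let U : ℕ → Set M₀ := fun k ↦ (extChartAt (𝓡 n) (g k)).source
  have hU : ⋃ k, U k = univ := by
    refine eq_univ_of_forall fun x ↦ ?_
    have hx : x ∈ ⋃ z ∈ range f, (extChartAt (𝓡 n) z).source := hcov ▸ mem_univ x
    simp only [mem_range, iUnion_exists, iUnion_iUnion_eq', mem_iUnion] at hx
    obtain ⟨k, hk⟩ := hx
    exact mem_iUnion.2 ⟨k + 1, hk⟩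
  have hUm : ∀ k, MeasurableSet (U k) := fun k ↦
    (isOpen_extChartAt_source (I := 𝓡 n) (g k)).measurableSet
  have hDm : ∀ k, MeasurableSet (disjointed U k) := fun k ↦ MeasurableSet.disjointed hUm k
  have hD : ⋃ k, disjointed U k = univ := by rw [iUnion_disjointed, hU]
  let ν : Measure M₀ := Measure.sum fun k ↦ (chartVolume n (g k)).restrict (disjointed U k)
  have hν : ∀ B, MeasurableSet B → ν B = ∑' k, chartVolume n (g k) (B ∩ disjointed U k) := by
    intro B hB
    rw [Measure.sum_apply _ hB]
    exact tsum_congr fun k ↦ Measure.restrict_apply hB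
  have hle : riemannianVolume n M₀ ≤ ν := by
    refine iSup_le fun x ↦ Measure.le_iff.2 fun B hB ↦ ?_
    have hBs : MeasurableSet (B ∩ (extChartAt (𝓡 n) x).source) :=
      hB.inter (isOpen_extChartAt_source (I := 𝓡 n) x).measurableSet
    have hdiff : chartVolume n x (B \ (extChartAt (𝓡 n) x).source) = 0 :=
      chartVolume_eq_zero_of_disjoint x
        (hB.diff (isOpen_extChartAt_source (I := 𝓡 n) x).measurableSet) disjoint_sdiff_left
    calc chartVolume n x B = chartVolume n x (B ∩ (extChartAt (𝓡 n) x).source) := by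
          rw [← measure_inter_add_sdiff B
            (isOpen_extChartAt_source (I := 𝓡 n) x).measurableSet, hdiff, add_zero]
      _ = ∑' k, chartVolume n x (B ∩ (extChartAt (𝓡 n) x).source ∩ disjointed U k) := by
          rw [← measure_iUnion, ← inter_iUnion, hD, inter_univ]
          · exact fun i j hij ↦ ((disjoint_disjointed U hij).mono inter_subset_right
              inter_subset_right)
          · exact fun k ↦ hBs.inter (hDm k)
      _ = ∑' k, chartVolume n (g k) (B ∩ (extChartAt (𝓡 n) x).source ∩ disjointed U k) :=
          tsum_congr fun k ↦ chartVolume_eq_of_subset x (g k) (hBs.inter (hDm k))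
            (inter_subset_left.trans inter_subset_right)
            (inter_subset_right.trans (disjointed_subset U k))
      _ ≤ ∑' k, chartVolume n (g k) (B ∩ disjointed U k) :=
          ENNReal.tsum_le_tsum fun k ↦ measure_mono
            (inter_subset_inter_left _ inter_subset_left)
      _ = ν B := (hν B hB).symm
  refine (hle A).trans ?_
  rw [hν A hA, tsum_eq_single 0]
  · exact measure_mono inter_subset_left
  · intro k hk
    have h0 : disjointed U 0 = U 0 := disjointed_zero U
    have hdis : Disjoint A (disjointed U k) :=
      (disjoint_disjointed U hk.symm).mono_left (by rw [h0]; exact hA₀)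
    rw [hdis.inter_eq, measure_empty]

/-- Isometries preserve the Riemannian volume. The domain and the range are required to lie in
single charts, which suffices for coverings. -/
theorem IsPartialIsometry.riemannianVolume_eq [IsManifold (𝓡 n) ∞ M₁] [MeasurableSpace M₁]
    [BorelSpace M₁] [SecondCountableTopology M₀]
    [SecondCountableTopology M₁] {e : OpenPartialHomeomorph M₁ M₀}
    (he : IsPartialIsometry n e) (y₀ : M₁) (x₀ : M₀)
    (hey : e.source ⊆ (extChartAt (𝓡 n) y₀).source)
    (hex : e.target ⊆ (extChartAt (𝓡 n) x₀).source) :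
    (riemannianVolume n M₁).restrict e.source =
      ((riemannianVolume n M₀).restrict e.target).map e.symm := by
  ext A hA
  have hm : AEMeasurable e.symm ((riemannianVolume n M₀).restrict e.target) :=
    e.continuousOn_symm.aemeasurable e.open_target.measurableSet
  have hAs : MeasurableSet (A ∩ e.source) := hA.inter e.open_source.measurableSet
  have hAt : MeasurableSet (e.target ∩ e.symm ⁻¹' A) :=
    e.continuousOn_symm.measurableSet_inter_preimage e.open_target.measurableSet hA
  have hset : e.target ∩ e.symm ⁻¹' (A ∩ e.source) = e.target ∩ e.symm ⁻¹' A := by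
    ext x
    simp only [mem_inter_iff, mem_preimage]
    exact ⟨fun h ↦ ⟨h.1, h.2.1⟩, fun h ↦ ⟨h.1, h.2, e.map_target h.1⟩⟩
  rw [Measure.restrict_apply hA, Measure.map_apply_of_aemeasurable hm hA,
    Measure.restrict_apply' e.open_target.measurableSet, inter_comm _ e.target,
    riemannianVolume_eq_chartVolume y₀ hAs (inter_subset_right.trans hey),
    riemannianVolume_eq_chartVolume x₀ hAt (inter_subset_left.trans hex),
    he.chartVolume_eq y₀ x₀ hAs inter_subset_right (inter_subset_right.trans hey)
      (fun y hy ↦ hex (e.map_source hy.2)), hset]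

variable [SecondCountableTopology M₀]
  [IsContMDiffRiemannianBundle (𝓡 n) ∞ (EuclideanSpace ℝ (Fin n))
    (fun x : M₀ ↦ TangentSpace (𝓡 n) x)]

variable (n M₀) in
theorem isLocallyFiniteMeasure_riemannianVolume :
    IsLocallyFiniteMeasure (riemannianVolume n M₀) := by
  refine ⟨fun x₀ ↦ ?_⟩
  have hc : ContinuousAt (chartDensity n x₀) (extChartAt (𝓡 n) x₀ x₀) :=
    (continuousOn_chartDensity x₀).continuousAt (extChartAt_target_mem_nhds x₀)
  have h1 : ∀ᶠ y in 𝓝 (extChartAt (𝓡 n) x₀ x₀),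
      chartDensity n x₀ y < chartDensity n x₀ (extChartAt (𝓡 n) x₀ x₀) + 1 :=
    hc.eventually_lt continuousAt_const (lt_add_one _)
  obtain ⟨r, hr, hball⟩ := Metric.mem_nhds_iff.1 h1
  have hopen : IsOpen ((extChartAt (𝓡 n) x₀).source ∩
      extChartAt (𝓡 n) x₀ ⁻¹' Metric.ball (extChartAt (𝓡 n) x₀ x₀) r) :=
    (continuousOn_extChartAt x₀).isOpen_inter_preimage (isOpen_extChartAt_source x₀)
      Metric.isOpen_ball
  refine ⟨_, hopen.mem_nhds ⟨mem_extChartAt_source x₀, Metric.mem_ball_self hr⟩, ?_⟩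
  rw [riemannianVolume_eq_chartVolume x₀ hopen.measurableSet inter_subset_left,
    chartVolume_apply x₀ hopen.measurableSet]
  have hsub : (extChartAt (𝓡 n) x₀).target ∩ (extChartAt (𝓡 n) x₀).symm ⁻¹'
      ((extChartAt (𝓡 n) x₀).source ∩
      extChartAt (𝓡 n) x₀ ⁻¹' Metric.ball (extChartAt (𝓡 n) x₀ x₀) r) ⊆
      Metric.ball (extChartAt (𝓡 n) x₀ x₀) r := by
    rintro y ⟨hy, -, hy2⟩
    rwa [mem_preimage, (extChartAt (𝓡 n) x₀).right_inv hy] at hy2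
  calc _ ≤ ∫⁻ y in Metric.ball (extChartAt (𝓡 n) x₀ x₀) r,
          ENNReal.ofReal (chartDensity n x₀ y) := lintegral_mono_set hsub
    _ ≤ ∫⁻ _ in Metric.ball (extChartAt (𝓡 n) x₀ x₀) r,
          ENNReal.ofReal (chartDensity n x₀ (extChartAt (𝓡 n) x₀ x₀) + 1) :=
        setLIntegral_mono' measurableSet_ball fun y hy ↦
          ENNReal.ofReal_le_ofReal (hball hy).le
    _ < ⊤ := by
        rw [setLIntegral_const]
        exact ENNReal.mul_lt_top ENNReal.ofReal_lt_top measure_ball_lt_top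

/-- Rademacher's theorem on a Riemannian manifold. It suffices to consider one chart at a time,
since null sets can be recognized locally. -/
theorem LipschitzWith.ae_mdifferentiableAt [IsRiemannianManifold (𝓡 n) M₀] {K : ℝ≥0}
    {f : M₀ → ℝ} (hf : LipschitzWith K f) :
    ∀ᵐ x ∂(riemannianVolume n M₀), MDifferentiableAt (𝓡 n) 𝓘(ℝ, ℝ) f x := by
  refine measure_null_of_locally_null _ fun x₀ hx₀ ↦ ?_
  obtain ⟨C, W, hW, hLip⟩ := exists_lipschitzOnWith_extChartAt_symm (n := n) x₀
  obtain ⟨r, hr, hball⟩ := Metric.mem_nhds_iff.1 hW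
  set B := Metric.ball (extChartAt (𝓡 n) x₀ x₀) r
  set F := f ∘ (extChartAt (𝓡 n) x₀).symm
  have hFL : LipschitzOnWith (K * C) F B := hf.comp_lipschitzOnWith (hLip.mono hball)
  let Z := B ∩ {y | DifferentiableAt ℝ F y}ᶜ
  have hZm : MeasurableSet Z :=
    measurableSet_ball.inter (measurableSet_of_differentiableAt ℝ F).compl
  have hZ0 : volume Z = 0 := by
    have h := hFL.ae_differentiableWithinAt_of_mem (μ := volume)
    refine measure_mono_null (fun y hy ↦ ?_) h
    intro hd
    exact hy.2 ((hd hy.1).differentiableAt (Metric.isOpen_ball.mem_nhds hy.1))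
  have hAm : MeasurableSet ((extChartAt (𝓡 n) x₀).source ∩ extChartAt (𝓡 n) x₀ ⁻¹' Z) :=
    (continuousOn_extChartAt x₀).measurableSet_inter_preimage
      (isOpen_extChartAt_source (I := 𝓡 n) x₀).measurableSet hZm
  refine ⟨(extChartAt (𝓡 n) x₀).source ∩ extChartAt (𝓡 n) x₀ ⁻¹' Z, ?_, ?_⟩
  · have hO : (extChartAt (𝓡 n) x₀).source ∩ extChartAt (𝓡 n) x₀ ⁻¹' B ∈ 𝓝 x₀ :=
      ((continuousOn_extChartAt x₀).isOpen_inter_preimage (isOpen_extChartAt_source x₀)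
        Metric.isOpen_ball).mem_nhds ⟨mem_extChartAt_source x₀, Metric.mem_ball_self hr⟩
    filter_upwards [self_mem_nhdsWithin, mem_nhdsWithin_of_mem_nhds hO] with x hxN hxO
    exact ⟨hxO.1, hxO.2, fun hd ↦ hxN
      ((mdifferentiableAt_iff_differentiableAt_comp_extChartAt_symm x₀ hxO.1).2 hd)⟩
  · rw [riemannianVolume_eq_chartVolume x₀ hAm inter_subset_left, chartVolume_apply x₀ hAm]
    refine setLIntegral_measure_zero _ _ (measure_mono_null ?_ hZ0)
    rintro y ⟨hy, -, hyZ⟩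
    rwa [mem_preimage, (extChartAt (𝓡 n) x₀).right_inv hy] at hyZ

/-- The norm of the gradient is measurable for an arbitrary function `f`, because the set of points
where `f` is not differentiable is measurable and the gradient vanishes there. -/
theorem measurable_norm_riemannianGradient (f : M₀ → ℝ) :
    Measurable fun x ↦ ‖riemannianGradient n f x‖ := by
  refine measurable_of_Iic fun c ↦ ?_
  rcases lt_or_ge c 0 with hc | hc
  · convert! MeasurableSet.empty
    ext x
    simpa using hc.trans_le (norm_nonneg _)
  obtain ⟨s, hs, hcov⟩ := TopologicalSpace.countable_cover_nhds
    fun x : M₀ ↦ extChartAt_source_mem_nhds (I := 𝓡 n) x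
  rw [← univ_inter ((fun x ↦ ‖riemannianGradient n f x‖) ⁻¹' Iic c), ← hcov, iUnion₂_inter]
  refine MeasurableSet.biUnion hs fun x₀ _ ↦ ?_
  set t := (extChartAt (𝓡 n) x₀).target
  have htm : MeasurableSet t := (isOpen_extChartAt_target (I := 𝓡 n) x₀).measurableSet
  let b : EuclideanSpace ℝ (Fin n) → EuclideanSpace ℝ (Fin n) → ℝ := fun v y ↦
    norm (E := TangentSpace (𝓡 n) ((extChartAt (𝓡 n) x₀).symm y))
          (mfderiv (𝓡 n) (𝓡 n) (extChartAt (𝓡 n) x₀).symm y v)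
  have hb : ∀ v, ContinuousOn (b v) t := fun v ↦ by
    refine (Real.continuous_sqrt.comp_continuousOn
      (continuousOn_inner_mfderiv_extChartAt_symm x₀ v v)).congr fun y _ ↦ ?_
    exact norm_eq_sqrt_real_inner _
  classical
  let Q : Set (EuclideanSpace ℝ (Fin n)) := t ∩ ⋂ k : ℕ,
    {y | |fderiv ℝ (f ∘ (extChartAt (𝓡 n) x₀).symm) y
          (TopologicalSpace.denseSeq (EuclideanSpace ℝ (Fin n)) k)| ≤ c * t.piecewise
          (b (TopologicalSpace.denseSeq (EuclideanSpace ℝ (Fin n)) k)) 0 y}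
  have hQ : MeasurableSet Q := by
    refine htm.inter (MeasurableSet.iInter fun k ↦ measurableSet_le ?_ ?_)
    · exact (measurable_fderiv_apply_const ℝ _ _).abs
    · exact ((hb _).measurable_piecewise continuousOn_const htm).const_mul c
  convert! (continuousOn_extChartAt x₀).measurableSet_inter_preimage
    (isOpen_extChartAt_source (I := 𝓡 n) x₀).measurableSet hQ using 1
  ext x
  simp only [mem_inter_iff, and_congr_right_iff]
  intro hx
  have hxt := (extChartAt (𝓡 n) x₀).map_source hx
  have h := norm_riemannianGradient_le_iff x₀ f hxt hc
  have hxx : ‖riemannianGradient n f ((extChartAt (𝓡 n) x₀).symm (extChartAt (𝓡 n) x₀ x))‖ =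
      ‖riemannianGradient n f x‖ :=
    congrArg (fun z ↦ ‖riemannianGradient n f z‖) ((extChartAt (𝓡 n) x₀).left_inv hx)
  rw [hxx] at h
  have hp : ∀ v, t.piecewise (b v) 0 (extChartAt (𝓡 n) x₀ x) = b v (extChartAt (𝓡 n) x₀ x) :=
    fun v ↦ piecewise_eq_of_mem _ _ _ hxt
  simp only [mem_preimage, mem_Iic, h, Q, mem_inter_iff, mem_iInter, mem_ofPred_eq, hp]
  exact ⟨fun h ↦ ⟨hxt, h⟩, fun h ↦ h.2⟩

theorem IsCompetitor.integrable_norm_riemannianGradient_sq [IsRiemannianManifold (𝓡 n) M₀]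
    {f : M₀ → ℝ} (hf : IsCompetitor f) :
    Integrable (fun x ↦ ‖riemannianGradient n f x‖ ^ 2) (riemannianVolume n M₀) := by
  obtain ⟨K, hK⟩ := hf.lipschitz
  have := isLocallyFiniteMeasure_riemannianVolume n M₀
  have hm : Measurable fun x : M₀ ↦ ‖riemannianGradient n f x‖ ^ 2 :=
    (measurable_norm_riemannianGradient f).pow_const 2
  have hloc : LocallyIntegrable (fun x ↦ ‖riemannianGradient n f x‖ ^ 2)
      (riemannianVolume n M₀) := by
    intro x
    obtain ⟨C, hC⟩ := hK.exists_norm_riemannianGradient_le (n := n) x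
    obtain ⟨U, hU, hUC⟩ := hC.exists_mem
    obtain ⟨W, hxW, hWo, hW⟩ := (riemannianVolume n M₀).exists_isOpen_measure_lt_top x
    obtain ⟨O, hOU, hO, hxO⟩ := mem_nhds_iff.1 (inter_mem hU (hWo.mem_nhds hxW))
    refine ⟨O, hO.mem_nhds hxO, IntegrableOn.of_bound
      ((measure_mono (hOU.trans inter_subset_right)).trans_lt hW) hm.aestronglyMeasurable (C ^ 2)
      ((ae_restrict_iff' hO.measurableSet).2 (Eventually.of_forall fun z hz ↦ ?_))⟩
    rw [Real.norm_of_nonneg (by positivity)]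
    exact pow_le_pow_left₀ (norm_nonneg _) (hUC z (hOU hz).1) 2
  have hint := hloc.integrableOn_isCompact hf.hasCompactSupport.isCompact
  refine (integrableOn_iff_integrable_of_support_subset fun x hx ↦ ?_).1 hint
  by_contra hxs
  exact hx (by simp [norm_riemannianGradient_eq_zero_of_notMem_tsupport hxs])

theorem IsCompetitor.integrable_mul_sq {f : M₀ → ℝ} (hf : IsCompetitor f) {W : M₀ → ℝ}
    (hW : Continuous W) : Integrable (fun x ↦ W x * f x ^ 2) (riemannianVolume n M₀) := by
  obtain ⟨K, hK⟩ := hf.lipschitz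
  have := isLocallyFiniteMeasure_riemannianVolume n M₀
  refine (hW.mul (hK.continuous.pow 2)).integrable_of_hasCompactSupport ?_
  refine hf.hasCompactSupport.mono fun x hx hfx ↦ hx ?_
  simp [hfx]

end Volume

/-! ### Coverings -/

/-- If `F² = ∑ Aᵢ²` with `F ≥ 0`, then `|dF|² ≤ ∑ |dAᵢ|²`. Away from the zeros of `F` this is the
Cauchy–Schwarz inequality applied to `F dF = ∑ Aᵢ dAᵢ`. -/
theorem sq_fderiv_apply_le_of_sq_eq_sum {E ι : Type*} [NormedAddCommGroup E] [NormedSpace ℝ E]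
    {s : Finset ι} {F : E → ℝ} {A : ι → E → ℝ} {y : E} (hF : ∀ z, 0 ≤ F z)
    (hA : ∀ i ∈ s, DifferentiableAt ℝ (A i) y) (h : ∀ᶠ z in 𝓝 y, F z ^ 2 = ∑ i ∈ s, A i z ^ 2)
    (v : E) : fderiv ℝ F y v ^ 2 ≤ ∑ i ∈ s, fderiv ℝ (A i) y v ^ 2 := by
  have hnonneg : 0 ≤ ∑ i ∈ s, fderiv ℝ (A i) y v ^ 2 := Finset.sum_nonneg fun _ _ ↦ sq_nonneg _
  -- `fderiv` is zero where `F` is not differentiable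
  by_cases hd : DifferentiableAt ℝ F y
  swap
  · simpa [fderiv_zero_of_not_differentiableAt hd] using hnonneg
  -- a zero of `F` is a minimum, where the derivative vanishes
  rcases (hF y).eq_or_lt with h0 | hpos
  · have hmin : IsLocalMin F y := Eventually.of_forall fun z ↦ by rw [← h0]; exact hF z
    simpa [hmin.fderiv_eq_zero] using hnonneg
  have h1 : HasFDerivAt (fun z ↦ F z ^ 2) _ y := hd.hasFDerivAt.pow 2
  have h2 : HasFDerivAt (fun z ↦ ∑ i ∈ s, A i z ^ 2) _ y :=
    HasFDerivAt.fun_sum fun i hi ↦ (hA i hi).hasFDerivAt.pow 2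
  have h3 := congr($(h1.unique (h2.congr_of_eventuallyEq h)) v)
  have h4 : F y * fderiv ℝ F y v = ∑ i ∈ s, A i y * fderiv ℝ (A i) y v := by
    simp only [smul_apply, sum_apply, smul_eq_mul,
      nsmul_eq_mul, Nat.cast_ofNat, Nat.add_one_sub_one, pow_one, mul_assoc, ← Finset.mul_sum] at h3
    linarith
  have h5 := Finset.sum_mul_sq_le_sq_mul_sq s (fun i ↦ A i y) fun i ↦ fderiv ℝ (A i) y v
  rw [← h4, ← h.self_of_nhds, mul_pow] at h5
  exact le_of_mul_le_mul_left h5 (by positivity)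

theorem lipschitzOnWith_sqrt_sum_sq {X ι : Type*} [PseudoEMetricSpace X] {s : Finset ι}
    {a : ι → X → ℝ} {K : ℝ≥0} {W : Set X} (h : ∀ i ∈ s, LipschitzOnWith K (a i) W) :
    ∃ C : ℝ≥0, LipschitzOnWith C (fun x ↦ √(∑ i ∈ s, a i x ^ 2)) W := by
  have h1 : LipschitzOnWith K (fun x ↦ fun i : s ↦ a i x) W := fun x hx y hy ↦
    edist_pi_le_iff.2 fun i ↦ h i i.2 hx hy
  have h2 := lipschitzWith_one_norm.comp_lipschitzOnWith
    ((PiLp.lipschitzWith_toLp 2 fun _ : s ↦ ℝ).comp_lipschitzOnWith h1)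
  have h3 : (fun x ↦ √(∑ i ∈ s, a i x ^ 2)) = norm ∘ WithLp.toLp 2 ∘ fun x (i : s) ↦ a i x := by
    ext x
    simp only [Function.comp_apply, EuclideanSpace.norm_eq, Real.norm_eq_abs, sq_abs]
    rw [Finset.sum_coe_sort s fun i ↦ a i x ^ 2]
  exact ⟨_, h3 ▸ h2⟩

section Covering

variable {n : ℕ} {M₀ M₁ : Type*}
    [EMetricSpace M₀] [ChartedSpace (EuclideanSpace ℝ (Fin n)) M₀]
    [RiemannianBundle (fun x : M₀ ↦ TangentSpace (𝓡 n) x)]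
    [EMetricSpace M₁] [ChartedSpace (EuclideanSpace ℝ (Fin n)) M₁]
    [RiemannianBundle (fun x : M₁ ↦ TangentSpace (𝓡 n) x)]
    {p : M₁ → M₀}

theorem IsRiemannianCovering.exists_isPartialIsometry (hp : IsRiemannianCovering n p) (y : M₁)
    {U : Set M₁} (hU : U ∈ 𝓝 y) :
    ∃ e : OpenPartialHomeomorph M₁ M₀, y ∈ e.source ∧ e.source ⊆ U ∧ ⇑e = p ∧
      IsPartialIsometry n e := by
  obtain ⟨e, hy, he⟩ := hp.isCoveringMap.isLocalHomeomorph y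
  refine ⟨e.restrOpen (interior U) isOpen_interior, ⟨hy, mem_interior_iff_mem_nhds.2 hU⟩,
    inter_subset_right.trans interior_subset, he.symm, ?_, ?_⟩
  · rw [OpenPartialHomeomorph.coe_restrOpen, ← he]
    exact hp.contMDiff.contMDiffOn
  · intro z _ v w
    have h := hp.inner_mfderiv z v w
    subst he
    exact h

/-- The part of the fibers over points near `x₀` which lies in a compact set `K` is contained in the
images of finitely many local sections, one through each point of `K` over `x₀`. Indeed the rest of
`K` has a compact image which does not contain `x₀`. The function `e` is defined on all of `M₁`,
but only its values on `s` are used. -/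
theorem IsRiemannianCovering.exists_local_sections (hp : IsRiemannianCovering n p) {K : Set M₁}
    (hK : IsCompact K) (x₀ : M₀) :
    ∃ (s : Finset M₁) (e : M₁ → OpenPartialHomeomorph M₁ M₀),
      (∀ y, ⇑(e y) = p ∧ IsPartialIsometry n (e y)) ∧
      (s : Set M₁).PairwiseDisjoint (fun y ↦ (e y).source) ∧
      ∀ᶠ x in 𝓝 x₀, (∀ y ∈ s, x ∈ (e y).target) ∧
        ∀ z ∈ K, p z = x → ∃ y ∈ s, z ∈ (e y).source := by
  have hcont : Continuous p := hp.isCoveringMap.continuous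
  have hfin : (K ∩ p ⁻¹' {x₀}).Finite := by
    refine (hK.inter_right (isClosed_singleton.preimage hcont)).finite ?_
    have : IsDiscrete (p ⁻¹' {x₀}) := ⟨(hp.isCoveringMap x₀).discreteTopology_fiber⟩
    exact this.mono inter_subset_right
  obtain ⟨U, hU, hdisj⟩ := hfin.t2_separation
  choose e hye heU hep he using fun y ↦
    hp.exists_isPartialIsometry y ((hU y).2.mem_nhds (hU y).1)
  refine ⟨hfin.toFinset, e, fun y ↦ ⟨hep y, he y⟩, ?_, ?_⟩
  · rw [hfin.coe_toFinset]
    exact hdisj.mono heU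
  have h1 : ∀ᶠ x in 𝓝 x₀, ∀ y ∈ hfin.toFinset, x ∈ (e y).target := by
    refine (Finset.eventually_all _).2 fun y hy ↦ (e y).open_target.mem_nhds ?_
    have : p y = x₀ := (hfin.mem_toFinset.1 hy).2
    rw [← this, ← hep y]
    exact (e y).map_source (hye y)
  have h2 : IsCompact (p '' (K \ ⋃ y ∈ hfin.toFinset, (e y).source)) :=
    (hK.diff (isOpen_biUnion fun y _ ↦ (e y).open_source)).image hcont
  have h3 : x₀ ∉ p '' (K \ ⋃ y ∈ hfin.toFinset, (e y).source) := by
    rintro ⟨z, ⟨hzK, hz⟩, hzx⟩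
    exact hz (mem_iUnion₂.2 ⟨z, hfin.mem_toFinset.2 ⟨hzK, hzx⟩, hye z⟩)
  filter_upwards [h1, h2.isClosed.isOpen_compl.mem_nhds h3] with x hx1 hx2
  refine ⟨hx1, fun z hz hzx ↦ ?_⟩
  by_contra hcon
  refine hx2 ⟨z, ⟨hz, fun hz' ↦ hcon ?_⟩, hzx⟩
  obtain ⟨y, hy, hzy⟩ := mem_iUnion₂.1 hz'
  exact ⟨y, hy, hzy⟩

/-- Sums over fibers of a function which vanishes outside of `K` are finite sums over local
sections. -/
theorem tsum_fiber_eq_sum {X Y α : Type*} [TopologicalSpace X] [TopologicalSpace Y]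
    [AddCommMonoid α] [TopologicalSpace α] {p : X → Y} {s : Finset X}
    {e : X → OpenPartialHomeomorph X Y} (hep : ∀ y, ⇑(e y) = p)
    (hdisj : (s : Set X).PairwiseDisjoint fun y ↦ (e y).source) {K : Set X} {x : Y}
    (hx : ∀ y ∈ s, x ∈ (e y).target) (hxK : ∀ z ∈ K, p z = x → ∃ y ∈ s, z ∈ (e y).source)
    {h : X → α} (hh : ∀ z ∉ K, h z = 0) :
    ∑' z : p ⁻¹' {x}, h z = ∑ y ∈ s, h ((e y).symm x) := by
  let g : s → p ⁻¹' {x} := fun y ↦ ⟨(e y).symm x, by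
    rw [mem_preimage, mem_singleton_iff, ← hep y, (e y).right_inv (hx y y.2)]⟩
  have hg : Function.Injective g := by
    intro y z hyz
    have h1 : (e y).symm x = (e z).symm x := congrArg Subtype.val hyz
    by_contra hne
    refine (hdisj y.2 z.2 fun h ↦ hne (Subtype.ext h)).notMem_of_mem_left
      ((e y).map_target (hx y y.2)) ?_
    rw [h1]
    exact (e z).map_target (hx z z.2)
  have hsupp : Function.support (fun z : p ⁻¹' {x} ↦ h z) ⊆ range g := by
    intro z hz
    have hzK : (z : X) ∈ K := by
      by_contra hzK
      exact hz (hh z hzK)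
    obtain ⟨y, hy, hzy⟩ := hxK z hzK z.2
    refine ⟨⟨y, hy⟩, Subtype.ext ?_⟩
    have : (e y).symm (e y z) = z := (e y).left_inv hzy
    rw [hep y, show p z = x from z.2] at this
    exact this
  rw [← hg.tsum_eq hsupp, tsum_fintype, Finset.sum_coe_sort s fun y ↦ h ((e y).symm x)]

/-- Integration over the total space of a Riemannian covering is integration over the base of the
sums over the fibers. The total space is partitioned into countably many measurable sets, each of
which is contained in a domain on which `p` is an isometry onto an open subset of `M₀`. The
measurability of the sums is needed to conclude that they vanish almost everywhere if their
integral does. -/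
theorem IsRiemannianCovering.aemeasurable_tsum_fiber_and_lintegral_eq
    [IsManifold (𝓡 n) ∞ M₀] [IsManifold (𝓡 n) ∞ M₁]
    [MeasurableSpace M₀] [BorelSpace M₀] [SecondCountableTopology M₀]
    [MeasurableSpace M₁] [BorelSpace M₁] [SecondCountableTopology M₁] [Nonempty M₁]
    (hp : IsRiemannianCovering n p) {F : M₁ → ℝ≥0∞} (hF : Measurable F) :
    AEMeasurable (fun x ↦ ∑' y : p ⁻¹' {x}, F y) (riemannianVolume n M₀) ∧
      ∫⁻ y, F y ∂(riemannianVolume n M₁) =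
        ∫⁻ x, ∑' y : p ⁻¹' {x}, F y ∂(riemannianVolume n M₀) := by
  have hcont : Continuous p := hp.isCoveringMap.continuous
  choose e hye heU hep he using fun y ↦ hp.exists_isPartialIsometry y
    (inter_mem (extChartAt_source_mem_nhds (I := 𝓡 n) y)
      (hcont.continuousAt.preimage_mem_nhds (extChartAt_source_mem_nhds (I := 𝓡 n) (p y))))
  obtain ⟨s, hs, hcov⟩ := TopologicalSpace.countable_cover_nhds
    fun y : M₁ ↦ (e y).open_source.mem_nhds (hye y)
  have hne : s.Nonempty := by
    by_contra h
    rw [not_nonempty_iff_eq_empty] at h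
    simp only [h, mem_empty_iff_false, iUnion_of_empty, iUnion_empty] at hcov
    exact empty_ne_univ hcov
  obtain ⟨c, rfl⟩ := hs.exists_eq_range hne
  rw [biUnion_range] at hcov
  let D : ℕ → Set M₁ := disjointed fun k ↦ (e (c k)).source
  have hDm : ∀ k, MeasurableSet (D k) := fun k ↦
    MeasurableSet.disjointed (fun k ↦ (e (c k)).open_source.measurableSet) k
  have hDs : ∀ k, D k ⊆ (e (c k)).source := fun k ↦ disjointed_subset _ k
  have hD : ⋃ k, D k = univ := by rw [iUnion_disjointed, hcov]
  have hDd : Pairwise (Function.onFun Disjoint D) := disjoint_disjointed _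
  -- the contribution of the piece `D k`, carried to the base
  let G : ℕ → M₀ → ℝ≥0∞ := fun k ↦ (e (c k)).target.indicator
    fun x ↦ (D k).indicator F ((e (c k)).symm x)
  have hvol : ∀ k, (riemannianVolume n M₁).restrict (e (c k)).source =
      ((riemannianVolume n M₀).restrict (e (c k)).target).map (e (c k)).symm := by
    intro k
    refine (he (c k)).riemannianVolume_eq (c k) (p (c k))
      ((heU _).trans inter_subset_left) fun x hx ↦ ?_
    have h := (heU _ ((e (c k)).map_target hx)).2
    rwa [mem_preimage, ← hep (c k), (e (c k)).right_inv hx, hep] at h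
  have hms : ∀ k, AEMeasurable (e (c k)).symm
      ((riemannianVolume n M₀).restrict (e (c k)).target) := fun k ↦
    (e (c k)).continuousOn_symm.aemeasurable (e (c k)).open_target.measurableSet
  have hDF : ∀ k, Measurable ((D k).indicator F) := fun k ↦ hF.indicator (hDm k)
  have hG : ∀ k, ∫⁻ y in D k, F y ∂(riemannianVolume n M₁) =
      ∫⁻ x, G k x ∂(riemannianVolume n M₀) := by
    intro k
    rw [lintegral_indicator (e (c k)).open_target.measurableSet,
      ← lintegral_map' (hDF k).aemeasurable (hms k), ← hvol, lintegral_indicator (hDm k),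
      Measure.restrict_restrict (hDm k), inter_eq_left.2 (hDs k)]
  have hGm : ∀ k, AEMeasurable (G k) (riemannianVolume n M₀) := fun k ↦
    (aemeasurable_indicator_iff (e (c k)).open_target.measurableSet).2
      ((hDF k).comp_aemeasurable (hms k))
  have hsum : ∀ y, F y = ∑' k, (D k).indicator F y := by
    intro y
    obtain ⟨k, hk⟩ := mem_iUnion.1 (hD ▸ mem_univ y : y ∈ ⋃ k, D k)
    rw [tsum_eq_single k, indicator_of_mem hk]
    intro j hj
    exact indicator_of_notMem ((hDd hj).notMem_of_mem_right hk) _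
  have hfiber : (fun x ↦ ∑' y : p ⁻¹' {x}, F y) = fun x ↦ ∑' k, G k x := by
    ext x
    simp only [hsum]
    rw [ENNReal.tsum_comm]
    refine tsum_congr fun k ↦ ?_
    by_cases hx : x ∈ (e (c k)).target
    · have hpx : p ((e (c k)).symm x) = x := by rw [← hep (c k), (e (c k)).right_inv hx]
      rw [tsum_eq_single (⟨(e (c k)).symm x, hpx⟩ : p ⁻¹' {x})]
      · exact (indicator_of_mem hx fun x ↦ (D k).indicator F ((e (c k)).symm x)).symm
      · intro z hz
        refine indicator_of_notMem (fun hzD ↦ hz (Subtype.ext ?_)) _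
        have h := (e (c k)).left_inv (hDs k hzD)
        rw [hep, show p z = x from z.2] at h
        exact h.symm
    · rw [show G k x = 0 from indicator_of_notMem hx _, ENNReal.tsum_eq_zero]
      intro z
      refine indicator_of_notMem (fun hzD ↦ hx ?_) _
      have h := (e (c k)).map_source (hDs k hzD)
      rwa [hep, show p z = x from z.2] at h
  simp only [hfiber]
  refine ⟨AEMeasurable.tsum hGm, ?_⟩
  rw [← setLIntegral_univ, ← hD, lintegral_iUnion hDm hDd, lintegral_tsum hGm]
  exact tsum_congr hG

/-- The `ℓ²` norm of `f` over the fibers of `p`. If `p` is a covering and `f` has compact support,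
then the sum is finite; a sum which does not converge counts as zero. -/
noncomputable def fiberNorm {X Y : Type*} (p : X → Y) (f : X → ℝ) (x : Y) : ℝ :=
  √(∑' z : p ⁻¹' {x}, f z ^ 2)

theorem IsRiemannianCovering.locallyLipschitz_fiberNorm [IsManifold (𝓡 n) ∞ M₀]
    [IsManifold (𝓡 n) ∞ M₁] [IsRiemannianManifold (𝓡 n) M₀] [IsRiemannianManifold (𝓡 n) M₁]
    (hp : IsRiemannianCovering n p) {f : M₁ → ℝ} (hf : IsCompetitor f) :
    LocallyLipschitz (fiberNorm p f) := by
  intro x₀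
  obtain ⟨K, hK⟩ := hf.lipschitz
  obtain ⟨s, e, he, hdisj, hev⟩ := hp.exists_local_sections hf.hasCompactSupport.isCompact x₀
  have hx₀ := hev.self_of_nhds.1
  have hlip : ∃ W ∈ 𝓝 x₀, ∀ y ∈ s, LipschitzOnWith 1 (e y).symm W := by
    choose W hW hWL using fun y : s ↦ (he y).2.exists_lipschitzOnWith_symm (hx₀ y y.2)
    exact ⟨⋂ y, W y, iInter_mem.2 hW, fun y hy ↦ (hWL ⟨y, hy⟩).mono (iInter_subset _ _)⟩
  obtain ⟨W, hW, hWL⟩ := hlip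
  obtain ⟨C, hC⟩ := lipschitzOnWith_sqrt_sum_sq (s := s) (a := fun y x ↦ f ((e y).symm x))
    (K := K * 1)
    fun y hy ↦ hK.comp_lipschitzOnWith (hWL y hy)
  obtain ⟨O, hO, hO'⟩ := hev.exists_mem
  refine ⟨C, W ∩ O, inter_mem hW hO, fun x hx y hy ↦ ?_⟩
  have hrep : ∀ x ∈ O, fiberNorm p f x = √(∑ y ∈ s, f ((e y).symm x) ^ 2) := fun x hx ↦ by
    rw [fiberNorm, tsum_fiber_eq_sum (h := fun z ↦ f z ^ 2) (fun y ↦ (he y).1) hdisj (hO' x hx).1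
      (hO' x hx).2 fun z hz ↦ by simp [image_eq_zero_of_notMem_tsupport hz]]
  rw [hrep x hx.2, hrep y hy.2]
  exact hC hx.1 hy.1

theorem IsRiemannianCovering.isCompetitor_fiberNorm [IsManifold (𝓡 n) ∞ M₀]
    [IsManifold (𝓡 n) ∞ M₁] [IsRiemannianManifold (𝓡 n) M₀] [IsRiemannianManifold (𝓡 n) M₁]
    (hp : IsRiemannianCovering n p) {f : M₁ → ℝ} (hf : IsCompetitor f) :
    IsCompetitor (fiberNorm p f) := by
  have hcont : Continuous p := hp.isCoveringMap.continuous
  have hc : HasCompactSupport (fiberNorm p f) := by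
    refine HasCompactSupport.intro (hf.hasCompactSupport.isCompact.image hcont) fun x hx ↦ ?_
    have : ∀ z : p ⁻¹' {x}, f z ^ 2 = 0 := fun z ↦ by
      have hz : (z : M₁) ∉ tsupport f := fun hz ↦ hx ⟨z, hz, z.2⟩
      simp [image_eq_zero_of_notMem_tsupport hz]
    simp [fiberNorm, this]
  refine ⟨(hp.locallyLipschitz_fiberNorm hf).exists_lipschitzWith_of_hasCompactSupport hc, hc, ?_⟩
  obtain ⟨y, hy⟩ := Function.ne_iff.1 hf.ne_zero
  refine fun h0 ↦ hy ?_
  obtain ⟨s, e, he, hdisj, hev⟩ := hp.exists_local_sections hf.hasCompactSupport.isCompact (p y)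
  have h1 : √(∑' z : p ⁻¹' {p y}, f z ^ 2) = 0 := congrFun h0 (p y)
  rw [tsum_fiber_eq_sum (h := fun z ↦ f z ^ 2) (fun y ↦ (he y).1) hdisj hev.self_of_nhds.1
    hev.self_of_nhds.2 fun z hz ↦ by simp [image_eq_zero_of_notMem_tsupport hz],
    Real.sqrt_eq_zero (Finset.sum_nonneg fun _ _ ↦ sq_nonneg _),
    Finset.sum_eq_zero_iff_of_nonneg fun _ _ ↦ sq_nonneg _] at h1
  obtain ⟨z, hz, hyz⟩ := hev.self_of_nhds.2 y (subset_tsupport f hy) rfl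
  have h2 := (e z).left_inv hyz
  rw [(he z).1] at h2
  have h3 := h1 z hz
  rw [h2] at h3
  exact pow_eq_zero_iff two_ne_zero |>.1 h3

/-- The pointwise inequality `|∇g|² ≤ ∑ |∇f|²`, summed over the fiber, for `g = fiberNorm p f`. The
function `g` itself need not be differentiable at `x`. -/
theorem IsRiemannianCovering.norm_riemannianGradient_fiberNorm_sq_le [IsManifold (𝓡 n) ∞ M₀]
    [IsManifold (𝓡 n) ∞ M₁] (hp : IsRiemannianCovering n p) {f : M₁ → ℝ}
    (hf : HasCompactSupport f) {x : M₀}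
    (hfd : ∀ z, p z = x → MDifferentiableAt (𝓡 n) 𝓘(ℝ, ℝ) f z) :
    ENNReal.ofReal (‖riemannianGradient n (fiberNorm p f) x‖ ^ 2) ≤
      ∑' z : p ⁻¹' {x}, ENNReal.ofReal (‖riemannianGradient n f z‖ ^ 2) := by
  obtain ⟨s, e, he, hdisj, hev⟩ := hp.exists_local_sections hf.isCompact x
  have hx := hev.self_of_nhds
  rw [tsum_fiber_eq_sum (h := fun z ↦ ENNReal.ofReal (‖riemannianGradient n f z‖ ^ 2))
    (fun y ↦ (he y).1) hdisj hx.1 hx.2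
    fun z hz ↦ by simp [norm_riemannianGradient_eq_zero_of_notMem_tsupport hz],
    ← ENNReal.ofReal_sum_of_nonneg fun _ _ ↦ sq_nonneg _]
  apply ENNReal.ofReal_le_ofReal
  set S := ∑ y ∈ s, ‖riemannianGradient n f ((e y).symm x)‖ ^ 2 with hS
  have hS0 : 0 ≤ S := Finset.sum_nonneg fun _ _ ↦ sq_nonneg _
  have hpx : ∀ y ∈ s, p ((e y).symm x) = x := fun y hy ↦ by
    rw [← (he y).1, (e y).right_inv (hx.1 y hy)]
  have hsx := mem_extChartAt_source (I := 𝓡 n) x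
  have hd : ∀ y ∈ s, MDifferentiableAt (𝓡 n) 𝓘(ℝ, ℝ) (f ∘ (e y).symm) x := fun y hy ↦
    (hfd _ (hpx y hy)).comp x ((he y).2.mdifferentiableAt_symm (hx.1 y hy))
  have hlim : Tendsto (extChartAt (𝓡 n) x).symm (𝓝 (extChartAt (𝓡 n) x x)) (𝓝 x) := by
    have := continuousAt_extChartAt_symm (I := 𝓡 n) x
    rwa [ContinuousAt, (extChartAt (𝓡 n) x).left_inv hsx] at this
  have hsq : ∀ᶠ z in 𝓝 (extChartAt (𝓡 n) x x),
      (fiberNorm p f ∘ (extChartAt (𝓡 n) x).symm) z ^ 2 =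
        ∑ y ∈ s, ((f ∘ (e y).symm) ∘ (extChartAt (𝓡 n) x).symm) z ^ 2 := by
    filter_upwards [hlim.eventually hev] with z hz
    rw [Function.comp_apply, fiberNorm, tsum_fiber_eq_sum (h := fun z ↦ f z ^ 2)
      (fun y ↦ (he y).1) hdisj hz.1 hz.2
      fun z hz ↦ by simp [image_eq_zero_of_notMem_tsupport hz],
      Real.sq_sqrt (Finset.sum_nonneg fun _ _ ↦ sq_nonneg _)]
    rfl
  have key : ‖riemannianGradient n (fiberNorm p f) x‖ ≤ √S := by
    rw [norm_riemannianGradient]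
    refine ContinuousLinearMap.opNorm_le_bound _ (Real.sqrt_nonneg _) fun w ↦ ?_
    rw [Real.norm_eq_abs]
    refine abs_le_of_sq_le_sq ?_ (by positivity)
    rw [differentialAt_eq_fderiv x _ hsx, mul_pow, Real.sq_sqrt hS0]
    refine (sq_fderiv_apply_le_of_sq_eq_sum (fun z ↦ Real.sqrt_nonneg _)
      (fun y hy ↦ (mdifferentiableAt_iff_differentiableAt_comp_extChartAt_symm x hsx).1 (hd y hy))
      hsq _).trans ?_
    rw [hS, Finset.sum_mul]
    refine Finset.sum_le_sum fun y hy ↦ ?_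
    rw [← differentialAt_eq_fderiv x _ hsx, ← mul_pow, norm_riemannianGradient]
    have h1 : differentialAt n (f ∘ (e y).symm) x w =
        differentialAt n f ((e y).symm x) (mfderiv (𝓡 n) (𝓡 n) (e y).symm x w) :=
      congr($(mfderiv_comp x (hfd _ (hpx y hy))
        ((he y).2.mdifferentiableAt_symm (hx.1 y hy))) w)
    rw [h1]
    have h2 : ‖differentialAt n f ((e y).symm x) (mfderiv (𝓡 n) (𝓡 n) (e y).symm x w)‖ ≤
        ‖differentialAt n f ((e y).symm x)‖ * ‖w‖ := by
      rw [← (he y).2.norm_mfderiv_symm (hx.1 y hy) w]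
      exact ContinuousLinearMap.le_opNorm _ _
    rw [Real.norm_eq_abs] at h2
    exact sq_le_sq' (abs_le.1 h2).1 (abs_le.1 h2).2
  calc _ ≤ √S ^ 2 := pow_le_pow_left₀ (norm_nonneg _) key 2
    _ = S := Real.sq_sqrt hS0

section Volume

variable [IsManifold (𝓡 n) ∞ M₀] [IsManifold (𝓡 n) ∞ M₁]
    [MeasurableSpace M₀] [BorelSpace M₀] [SecondCountableTopology M₀]
    [MeasurableSpace M₁] [BorelSpace M₁] [SecondCountableTopology M₁] [Nonempty M₁]
    [IsRiemannianManifold (𝓡 n) M₁]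

theorem IsRiemannianCovering.integral_mul_fiberNorm_sq_of_nonneg
    [IsRiemannianManifold (𝓡 n) M₀] (hp : IsRiemannianCovering n p)
    {f : M₁ → ℝ} (hf : IsCompetitor f) {W : M₀ → ℝ} (hW : Continuous W) (hW0 : ∀ x, 0 ≤ W x) :
    ∫ x, W x * fiberNorm p f x ^ 2 ∂(riemannianVolume n M₀) =
      ∫ y, W (p y) * f y ^ 2 ∂(riemannianVolume n M₁) := by
  have hcont : Continuous p := hp.isCoveringMap.continuous
  obtain ⟨K, hK⟩ := hf.lipschitz
  obtain ⟨K', hK'⟩ := (hp.isCompetitor_fiberNorm hf).lipschitz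
  have hc1 : Continuous fun y ↦ W (p y) * f y ^ 2 := (hW.comp hcont).mul (hK.continuous.pow 2)
  have hc0 : Continuous fun x ↦ W x * fiberNorm p f x ^ 2 := hW.mul (hK'.continuous.pow 2)
  rw [integral_eq_lintegral_of_nonneg_ae (Eventually.of_forall fun x ↦
      mul_nonneg (hW0 x) (sq_nonneg _)) hc0.aestronglyMeasurable,
    integral_eq_lintegral_of_nonneg_ae (Eventually.of_forall fun y ↦
      mul_nonneg (hW0 (p y)) (sq_nonneg _)) hc1.aestronglyMeasurable,
    (hp.aemeasurable_tsum_fiber_and_lintegral_eq hc1.measurable.ennreal_ofReal).2]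
  congr 1
  refine lintegral_congr fun x ↦ ?_
  obtain ⟨s, e, he, hdisj, hev⟩ := hp.exists_local_sections hf.hasCompactSupport.isCompact x
  have hx := hev.self_of_nhds
  rw [fiberNorm, tsum_fiber_eq_sum (h := fun z ↦ f z ^ 2) (fun y ↦ (he y).1) hdisj hx.1 hx.2
    fun z hz ↦ by simp [image_eq_zero_of_notMem_tsupport hz],
    tsum_fiber_eq_sum (h := fun z ↦ ENNReal.ofReal (W (p z) * f z ^ 2)) (fun y ↦ (he y).1) hdisj
    hx.1 hx.2 fun z hz ↦ by simp [image_eq_zero_of_notMem_tsupport hz],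
    Real.sq_sqrt (Finset.sum_nonneg fun _ _ ↦ sq_nonneg _), Finset.mul_sum,
    ENNReal.ofReal_sum_of_nonneg fun _ _ ↦ mul_nonneg (hW0 x) (sq_nonneg _)]
  refine Finset.sum_congr rfl fun y hy ↦ ?_
  rw [← (he y).1, (e y).right_inv (hx.1 y hy)]

variable
    [IsContMDiffRiemannianBundle (𝓡 n) ∞ (EuclideanSpace ℝ (Fin n))
      (fun x : M₀ ↦ TangentSpace (𝓡 n) x)]
    [IsContMDiffRiemannianBundle (𝓡 n) ∞ (EuclideanSpace ℝ (Fin n))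
      (fun x : M₁ ↦ TangentSpace (𝓡 n) x)]

/-- The case of weights of arbitrary sign follows by splitting the weight into its positive and
negative parts. -/
theorem IsRiemannianCovering.integral_mul_fiberNorm_sq
    [IsRiemannianManifold (𝓡 n) M₀] (hp : IsRiemannianCovering n p)
    {f : M₁ → ℝ} (hf : IsCompetitor f) {W : M₀ → ℝ} (hW : Continuous W) :
    ∫ x, W x * fiberNorm p f x ^ 2 ∂(riemannianVolume n M₀) =
      ∫ y, W (p y) * f y ^ 2 ∂(riemannianVolume n M₁) := by
  have hcont : Continuous p := hp.isCoveringMap.continuous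
  have hg := hp.isCompetitor_fiberNorm hf
  have h1 : Continuous fun x ↦ max (W x) 0 := hW.max continuous_const
  have h2 : Continuous fun x ↦ max (-W x) 0 := hW.neg.max continuous_const
  have hsplit : ∀ x, W x = max (W x) 0 - max (-W x) 0 := fun x ↦
    (posPart_sub_negPart (W x)).symm
  have e1 := hp.integral_mul_fiberNorm_sq_of_nonneg hf h1 fun _ ↦ le_max_right _ _
  have e2 := hp.integral_mul_fiberNorm_sq_of_nonneg hf h2 fun _ ↦ le_max_right _ _
  calc ∫ x, W x * fiberNorm p f x ^ 2 ∂(riemannianVolume n M₀)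
      = ∫ x, (max (W x) 0 * fiberNorm p f x ^ 2 - max (-W x) 0 * fiberNorm p f x ^ 2)
          ∂(riemannianVolume n M₀) := by
        refine integral_congr_ae (Eventually.of_forall fun x ↦ ?_)
        simp only [← sub_mul, ← hsplit]
    _ = ∫ y, (max (W (p y)) 0 * f y ^ 2 - max (-W (p y)) 0 * f y ^ 2)
          ∂(riemannianVolume n M₁) := by
        have i1 : Integrable (fun y ↦ max (W (p y)) 0 * f y ^ 2) (riemannianVolume n M₁) :=
          hf.integrable_mul_sq (h1.comp hcont)
        have i2 : Integrable (fun y ↦ max (-W (p y)) 0 * f y ^ 2) (riemannianVolume n M₁) :=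
          hf.integrable_mul_sq (h2.comp hcont)
        rw [integral_sub (hg.integrable_mul_sq h1) (hg.integrable_mul_sq h2), e1, e2,
          integral_sub i1 i2]
    _ = _ := by
        refine integral_congr_ae (Eventually.of_forall fun y ↦ ?_)
        simp only [← sub_mul, ← hsplit]

theorem IsRiemannianCovering.integral_norm_riemannianGradient_fiberNorm_sq_le
    (hp : IsRiemannianCovering n p) {f : M₁ → ℝ} (hf : IsCompetitor f) :
    ∫ x, ‖riemannianGradient n (fiberNorm p f) x‖ ^ 2 ∂(riemannianVolume n M₀) ≤
      ∫ y, ‖riemannianGradient n f y‖ ^ 2 ∂(riemannianVolume n M₁) := by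
  obtain ⟨K, hK⟩ := hf.lipschitz
  have hint := hf.integrable_norm_riemannianGradient_sq (n := n)
  rw [integral_eq_lintegral_of_nonneg_ae (Eventually.of_forall fun x ↦ sq_nonneg _)
      ((measurable_norm_riemannianGradient _).pow_const 2).aestronglyMeasurable,
    integral_eq_lintegral_of_nonneg_ae (Eventually.of_forall fun y ↦ sq_nonneg _)
      hint.aestronglyMeasurable]
  refine ENNReal.toReal_mono (hint.lintegral_lt_top).ne ?_
  rw [(hp.aemeasurable_tsum_fiber_and_lintegral_eq
    ((measurable_norm_riemannianGradient f).pow_const 2).ennreal_ofReal).2]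
  refine lintegral_mono_ae ?_
  -- the points over which `f` fails to be differentiable at some point of the fiber form a null
  -- set: apply the integration formula to the indicator of a measurable null set
  -- containing the points of non-differentiability
  have hnull := measure_toMeasurable
    (μ := riemannianVolume n M₁) {z | ¬ MDifferentiableAt (𝓡 n) 𝓘(ℝ, ℝ) f z}
  set N := toMeasurable (riemannianVolume n M₁) {z | ¬ MDifferentiableAt (𝓡 n) 𝓘(ℝ, ℝ) f z}
  have hNm : MeasurableSet N := measurableSet_toMeasurable _ _
  rw [show riemannianVolume n M₁ {z | ¬ MDifferentiableAt (𝓡 n) 𝓘(ℝ, ℝ) f z} = 0 from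
    hK.ae_mdifferentiableAt] at hnull
  obtain ⟨hm, h0⟩ := hp.aemeasurable_tsum_fiber_and_lintegral_eq (F := N.indicator 1)
    (measurable_one.indicator hNm)
  rw [lintegral_indicator_one hNm, hnull, eq_comm, lintegral_eq_zero_iff' hm] at h0
  filter_upwards [h0] with x hx
  refine hp.norm_riemannianGradient_fiberNorm_sq_le hf.hasCompactSupport fun z hz ↦ ?_
  by_contra hzd
  have h1 := ENNReal.tsum_eq_zero.1 hx ⟨z, hz⟩
  rw [indicator_of_mem (subset_toMeasurable _ _ hzd)] at h1
  exact one_ne_zero h1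

end Volume

end Covering

theorem theorem1p1 (n : ℕ) {M₀ M₁ : Type*}
    [EMetricSpace M₀] [ConnectedSpace M₀] [SecondCountableTopology M₀]
    [MeasurableSpace M₀] [BorelSpace M₀]
    [ChartedSpace (EuclideanSpace ℝ (Fin n)) M₀] [IsManifold (𝓡 n) ∞ M₀]
    [RiemannianBundle (fun x : M₀ ↦ TangentSpace (𝓡 n) x)]
    [IsContMDiffRiemannianBundle (𝓡 n) ∞ (EuclideanSpace ℝ (Fin n))
      (fun x : M₀ ↦ TangentSpace (𝓡 n) x)]
    [IsRiemannianManifold (𝓡 n) M₀]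
    [EMetricSpace M₁] [ConnectedSpace M₁] [SecondCountableTopology M₁]
    [MeasurableSpace M₁] [BorelSpace M₁]
    [ChartedSpace (EuclideanSpace ℝ (Fin n)) M₁] [IsManifold (𝓡 n) ∞ M₁]
    [RiemannianBundle (fun x : M₁ ↦ TangentSpace (𝓡 n) x)]
    [IsContMDiffRiemannianBundle (𝓡 n) ∞ (EuclideanSpace ℝ (Fin n))
      (fun x : M₁ ↦ TangentSpace (𝓡 n) x)]
    [IsRiemannianManifold (𝓡 n) M₁]
    (p : M₁ → M₀) (hp : IsRiemannianCovering n p)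
    (V₀ : M₀ → ℝ) (hV₀ : ContMDiff (𝓡 n) 𝓘(ℝ, ℝ) ∞ V₀)
    (V₁ : M₁ → ℝ) (hV₁ : V₁ = V₀ ∘ p) :
    bottomOfSpectrum n V₀ ≤ bottomOfSpectrum n V₁ := by
  subst hV₁
  have hcont : Continuous p := hp.isCoveringMap.continuous
  refine le_iInf₂ fun f hf ↦ ?_
  have hg := hp.isCompetitor_fiberNorm hf
  refine iInf₂_le_of_le (fiberNorm p f) hg (EReal.coe_le_coe_iff.2 ?_)
  have hden : ∫ x, fiberNorm p f x ^ 2 ∂(riemannianVolume n M₀) =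
      ∫ y, f y ^ 2 ∂(riemannianVolume n M₁) := by
    simpa using hp.integral_mul_fiberNorm_sq hf (W := fun _ ↦ 1) continuous_const
  rw [rayleighQuotient, rayleighQuotient, hden]
  refine div_le_div_of_nonneg_right ?_ (integral_nonneg fun _ ↦ sq_nonneg _)
  rw [integral_add hg.integrable_norm_riemannianGradient_sq
      (hg.integrable_mul_sq hV₀.continuous),
    integral_add hf.integrable_norm_riemannianGradient_sq
      (hf.integrable_mul_sq (hV₀.continuous.comp hcont)),
    hp.integral_mul_fiberNorm_sq hf hV₀.continuous]
  exact add_le_add_left (hp.integral_norm_riemannianGradient_fiberNorm_sq_le hf) _
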